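/- **Graphs.** A graph consists of a set of vertices, a set $D$ of darts, an assignment of each dart to a vertex, and a partition of $D$ into sets of size one or two, called links (a link is a semi-edge if it has one dart, a loop if it has two darts at the same vertex, a normal edge if it has two darts at distinct vertices). Multiple links and isolated vertices are allowed; all graphs are finite. The size of a graph is its number of vertices plus its number of links. Connected components are the subgraphs induced by the classes of vertices that can be joined by normal edges. **Covers.** A covering projection of a graph $G$ onto a connected graph $H$ is a surjective mapping (of vertices and of darts) that maps the darts at each vertex $u$ of $G$ bijectively onto the darts at the image of $u$, and maps every link of $G$ onto a link of $H$. If such a mapping exists, $G$ covers $H$. For possibly disconnected graphs $G$ and $H$, a surjective covering projection of $G$ to $H$ is a surjective mapping whose restriction to every component of $G$ is a covering projection onto some component of $H$. **Problems.** For a fixed connected graph $B$, $B$-Cover asks whether an input graph $G$ covers $B$. For a fixed graph $H$, $H$-SurjectiveCover asks whether an input graph $G$ admits a surjective covering projection to $H$. In SurjectiveCover both $G$ and $H$ are part of the input. The input size is the size of $G$, respectively the sum of the sizes of $G$ and $H$. Input graphs $G$ are arbitrary. **Theorem.** (i) Let $H$ be a graph such that $H_i$-Cover is solvable in polynomial time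 for every connected component $H_i$ of $H$. Then $H$-SurjectiveCover is solvable in polynomial time. Let $\mathcal P$ be the class of all pairs $(G,H)$ of graphs such that $H_i$-Cover is solvable in polynomial time for every connected component $H_i$ of $H$. (ii) SurjectiveCover on inputs from $\mathcal P$ is in XP (slicewise polynomial) when parameterized by the maximum size of a component of $H$: there are functions $f,g:\mathbb N\to\mathbb N$ such that for every $k$ there is an algorithm which, for every $(G,H)\in\mathcal P$ with input size $n$, decides in time at most $f(k)\,(n+1)^{g(k)}$ whether the maximum size of a component of $H$ equals $k$ and $G$ admits a surjective covering projection to $H$. (iii) For every $M$, SurjectiveCover on the inputs $(G,H)\in\mathcal P$ in which all components of $H$ have size at most $M$ is solvable in polynomial time. -/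

import Mathlib

/-! ### A model of computation with a step count

The textbook WHILE language over binary trees (N. D. Jones): finitely many variables hold
binary trees, the elementary operations are the constant `nil`, pairing, the two projections
and the test for `nil`, each of cost one. Polynomial time in this model is polynomial time on
Turing machines. -/

/-- Binary trees, the data of the WHILE language. -/
inductive Data : Type where
  | nil : Data
  | cons : Data → Data → Data

namespace Data

/-- First component of a pair; `hd nil = nil`. -/
def hd : Data → Data
  | nil => nil
  | cons a _ => a

/-- Second component of a pair; `tl nil = nil`. -/
def tl : Data → Data
  | nil => nil
  | cons _ b => b

/-- Lists as right-nested pairs. -/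
def ofList : List Data → Data
  | [] => nil
  | a :: l => cons a (ofList l)

/-- Natural numbers in unary. -/
def ofNat : ℕ → Data
  | 0 => nil
  | n + 1 => cons nil (ofNat n)

end Data

/-- A store assigns a tree to every variable; a program mentions only finitely many of them. -/
abbrev Store : Type := ℕ → Data

/-- Expressions of the WHILE language. -/
inductive Expr : Type where
  | var : ℕ → Expr
  | nil : Expr
  | cons : Expr → Expr → Expr
  | hd : Expr → Expr
  | tl : Expr → Expr

namespace Expr

/-- Value of an expression in a store. -/
def eval (s : Store) : Expr → Data
  | var x => s x
  | nil => Data.nil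
  | cons a b => Data.cons (a.eval s) (b.eval s)
  | hd a => (a.eval s).hd
  | tl a => (a.eval s).tl

/-- Cost of an evaluation: one step for every operation in the expression. -/
def cost : Expr → ℕ
  | var _ => 1
  | nil => 1
  | cons a b => a.cost + b.cost + 1
  | hd a => a.cost + 1
  | tl a => a.cost + 1

end Expr

/-- Commands of the WHILE language; `loop e c` is `while e ≠ nil do c`. -/
inductive Cmd : Type where
  | assign : ℕ → Expr → Cmd
  | seq : Cmd → Cmd → Cmd
  | ite : Expr → Cmd → Cmd → Cmd
  | loop : Expr → Cmd → Cmd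

/-- `Exec c s t n`: started in the store `s`, the command `c` halts in the store `t` after
exactly `n` steps. -/
inductive Exec : Cmd → Store → Store → ℕ → Prop where
  | assign (x : ℕ) (e : Expr) (s : Store) :
      Exec (Cmd.assign x e) s (Function.update s x (e.eval s)) (e.cost + 1)
  | seq {c d : Cmd} {s t u : Store} {m n : ℕ} :
      Exec c s t m → Exec d t u n → Exec (Cmd.seq c d) s u (m + n)
  | ite_true {e : Expr} {c d : Cmd} {s t : Store} {n : ℕ} :
      e.eval s ≠ Data.nil → Exec c s t n → Exec (Cmd.ite e c d) s t (e.cost + 1 + n)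
  | ite_false {e : Expr} {c d : Cmd} {s t : Store} {n : ℕ} :
      e.eval s = Data.nil → Exec d s t n → Exec (Cmd.ite e c d) s t (e.cost + 1 + n)
  | loop_done {e : Expr} {c : Cmd} {s : Store} :
      e.eval s = Data.nil → Exec (Cmd.loop e c) s s (e.cost + 1)
  | loop_step {e : Expr} {c : Cmd} {s t u : Store} {m n : ℕ} :
      e.eval s ≠ Data.nil → Exec c s t m → Exec (Cmd.loop e c) t u n →
      Exec (Cmd.loop e c) s u (e.cost + 1 + m + n)

/-- The initial store: the input is in variable `0`, all other variables hold `nil`. -/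
def Store.init (a : Data) : Store := Function.update (fun _ => Data.nil) 0 a

/-- On input `a` the program `p` halts within `T` steps, and it accepts (variable `0` is not
`nil` at the end) if and only if `answer` holds. -/
def Cmd.DecidesWithin (p : Cmd) (a : Data) (answer : Prop) (T : ℕ) : Prop :=
  ∃ (t : Store) (n : ℕ), Exec p (Store.init a) t n ∧ n ≤ T ∧ (t 0 ≠ Data.nil ↔ answer)

/-- A decision problem with a promise: the instances with their encoding and size, the set of
instances that are admitted as inputs, and the set of yes-instances. -/
structure DecisionProblem where
  /-- the instances -/
  Inst : Type
  /-- the encoding of an instance as an input -/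
  encode : Inst → Data
  /-- the input size -/
  size : Inst → ℕ
  /-- the admitted inputs -/
  promise : Inst → Prop
  /-- the yes-instances -/
  yes : Inst → Prop

namespace DecisionProblem

/-- Some program decides the problem on all admitted inputs in time polynomial in their size. -/
def PolyTime (Q : DecisionProblem) : Prop :=
  ∃ (p : Cmd) (k : ℕ), ∀ x : Q.Inst, Q.promise x →
    p.DecidesWithin (Q.encode x) (Q.yes x) (k * Q.size x ^ k + k)

/-- Slicewise polynomial (XP) with respect to the parameter `κ`: for every `k`, the `k`-th slice
`{x | x is a yes-instance and κ x = k}` is decided, on all admitted inputs, in time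
`f k * n ^ g k`, where `n` is one plus the input size. -/
def InXP (Q : DecisionProblem) (κ : Q.Inst → ℕ) : Prop :=
  ∃ f g : ℕ → ℕ, ∀ k : ℕ, ∃ p : Cmd, ∀ x : Q.Inst, Q.promise x →
    p.DecidesWithin (Q.encode x) (Q.yes x ∧ κ x = k) (f k * (Q.size x + 1) ^ g k)

/-- The problem with its inputs restricted to those that satisfy `P`. -/
def restrict (Q : DecisionProblem) (P : Q.Inst → Prop) : DecisionProblem :=
  { Q with promise := fun x => Q.promise x ∧ P x }

end DecisionProblem

/-! ### Graphs with multiple edges, loops and semi-edges -/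

/-- A graph with vertex set `V` and dart set `D`. Each dart sits at a vertex `base d` (a vertex
corresponds to the set of its darts, which is empty for an isolated vertex), and the links, sets
of one or two darts that partition `D`, are the orbits `{d, inv d}` of the involution `inv`.
A link is a semi-edge if it has one dart, a loop if it has two darts at the same vertex, and a
normal edge if it has two darts at distinct vertices. -/
structure DartGraph (V D : Type*) where
  /-- the vertex to which a dart belongs -/
  base : D → V
  /-- the other dart of the same link (the dart itself for a semi-edge) -/
  inv : D → D
  inv_inv : ∀ d, inv (inv d) = d

namespace DartGraph

variable {V D V' D' : Type*}

/-- The links (normal edges, loops and semi-edges). -/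
def links (G : DartGraph V D) : Set (Set D) := Set.range fun d => {d, G.inv d}

/-- The size of a graph: the number of its vertices plus the number of its links. -/
noncomputable def size (G : DartGraph V D) : ℕ := Nat.card V + G.links.ncard

/-- The simple graph of adjacency: distinct vertices are adjacent if a link joins them. -/
def adjacency (G : DartGraph V D) : SimpleGraph V :=
  SimpleGraph.fromRel fun u v => ∃ d, G.base d = u ∧ G.base (G.inv d) = v

/-- The (index set of the) connected components. -/
abbrev Component (G : DartGraph V D) : Type _ := G.adjacency.ConnectedComponent

theorem base_inv_mem_supp (G : DartGraph V D) (c : G.Component) {d : D}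
    (h : G.base d ∈ c.supp) : G.base (G.inv d) ∈ c.supp := by
  rw [SimpleGraph.ConnectedComponent.mem_supp_iff] at h ⊢
  rw [← h, SimpleGraph.ConnectedComponent.eq]
  by_cases e : G.base (G.inv d) = G.base d
  · rw [e]
  · refine SimpleGraph.Adj.reachable ?_
    exact (SimpleGraph.fromRel_adj _ _ _).2 ⟨e, Or.inr ⟨d, rfl, rfl⟩⟩

/-- A connected component as a graph: the subgraph induced by its vertices. -/
def component (G : DartGraph V D) (c : G.Component) :
    DartGraph {v : V // v ∈ c.supp} {d : D // G.base d ∈ c.supp} where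
  base d := ⟨G.base d, d.2⟩
  inv d := ⟨G.inv d, G.base_inv_mem_supp c d.2⟩
  inv_inv d := Subtype.ext (G.inv_inv d)

/-- The maximum size of a connected component (`0` for the graph without vertices). -/
noncomputable def maxComponentSize (G : DartGraph V D) : ℕ := ⨆ c : G.Component, (G.component c).size

/-- Covering projections of a graph onto a connected graph `H`: surjective, mapping the darts at
every vertex bijectively onto the darts at its image, and mapping links onto links
(`fD '' {d, inv d}` is a link if and only if `fD` commutes with `inv` at `d`). -/
structure IsCoveringProjection (G : DartGraph V D) (H : DartGraph V' D')
    (fV : V → V') (fD : D → D') : Prop where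
  surjective_vertices : Function.Surjective fV
  surjective_darts : Function.Surjective fD
  bijOn_darts : ∀ u : V, Set.BijOn fD {d | G.base d = u} {d | H.base d = fV u}
  map_inv : ∀ d : D, fD (G.inv d) = H.inv (fD d)

/-- `G` covers `H` (used for connected `H`). -/
def Covers (G : DartGraph V D) (H : DartGraph V' D') : Prop :=
  ∃ (fV : V → V') (fD : D → D'), IsCoveringProjection G H fV fD

/-- Surjective covering projections between possibly disconnected graphs: the restriction to
every component of `G` is a covering projection onto some component of `H`, and the mapping is
surjective. -/
structure IsSurjectiveCoveringProjection (G : DartGraph V D) (H : DartGraph V' D')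
    (fV : V → V') (fD : D → D') : Prop where
  restriction : ∀ c : G.Component, ∃ (c' : H.Component)
    (gV : {v : V // v ∈ c.supp} → {v : V' // v ∈ c'.supp})
    (gD : {d : D // G.base d ∈ c.supp} → {d : D' // H.base d ∈ c'.supp}),
    (∀ v, (gV v : V') = fV v) ∧ (∀ d, (gD d : D') = fD d) ∧
      IsCoveringProjection (G.component c) (H.component c') gV gD
  surjective_vertices : Function.Surjective fV
  surjective_darts : Function.Surjective fD

/-- `G` admits a surjective covering projection to `H`. -/
def SurjectivelyCovers (G : DartGraph V D) (H : DartGraph V' D') : Prop :=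
  ∃ (fV : V → V') (fD : D → D'), IsSurjectiveCoveringProjection G H fV fD

end DartGraph

/-! ### The decision problems -/

/-- Input graphs: finite graphs with numbered vertices and darts. -/
structure InputGraph where
  /-- number of vertices -/
  numVertices : ℕ
  /-- number of darts -/
  numDarts : ℕ
  /-- the graph itself -/
  graph : DartGraph (Fin numVertices) (Fin numDarts)

/-- The number of vertices, followed by the list of the pairs `(base d, inv d)`. -/
def InputGraph.encode (G : InputGraph) : Data :=
  Data.cons (Data.ofNat G.numVertices) (Data.ofList (List.ofFn fun d : Fin G.numDarts =>
    Data.cons (Data.ofNat (G.graph.base d)) (Data.ofNat (G.graph.inv d))))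

namespace DartGraph

variable {V D : Type*}

/-- The problem `H`-Cover: given a graph `G`, does `G` cover the fixed connected graph `H`? -/
noncomputable def coverProblem (H : DartGraph V D) : DecisionProblem where
  Inst := InputGraph
  encode := InputGraph.encode
  size G := G.graph.size
  promise _ := True
  yes G := G.graph.Covers H

/-- The problem `H`-SurjectiveCover: given a graph `G`, does `G` admit a surjective covering
projection to the fixed graph `H`? -/
noncomputable def surjectiveCoverProblem (H : DartGraph V D) : DecisionProblem where
  Inst := InputGraph
  encode := InputGraph.encode
  size G := G.graph.size
  promise _ := True
  yes G := G.graph.SurjectivelyCovers H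

/-- `C`-Cover is solvable in polynomial time for every connected component `C` of `H`. -/
def ComponentsPolyTime (H : DartGraph V D) : Prop :=
  ∀ c : H.Component, (H.component c).coverProblem.PolyTime

end DartGraph

/-- The problem SurjectiveCover: given graphs `G` and `H`, does `G` admit a surjective covering
projection to `H`? -/
noncomputable def surjectiveCover : DecisionProblem where
  Inst := InputGraph × InputGraph
  encode x := Data.cons x.1.encode x.2.encode
  size x := x.1.graph.size + x.2.graph.size
  promise _ := True
  yes x := x.1.graph.SurjectivelyCovers x.2.graph

/-! Only components matter. A surjective covering projection sends every component of `G` onto a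
component of `H` that it covers, and this assignment is onto; a section of it is an injection `f`
from the components of `H` to those of `G` such that `f c'` covers `c'`. Conversely, such an
injection can be glued to a surjective covering projection as soon as every component of `G` covers
some component of `H` (`surjectivelyCovers_iff`). By Hall's theorem the injection exists iff, for
every set `S` of components of `H`, at least `|S|` components of `G` cover a member of `S`
(`surjectivelyCovers_iff_card`). For fixed `H` this is a constant number of counts, made with the
given programs for the components as subroutines.

When `H` is part of the input and its components have size at most `k`, they fall into finitely many
types, because there are finitely many numbered graphs of size at most `k` (`finite_size_le`).
Enlarging `S` to all components of the same types can only raise the left side of Hall's inequality,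
so testing sets of types suffices (`surjectivelyCovers_iff_types`), and their number depends on `k`
alone. One program, with the deciders for all easy types of size at most `k` built in, then serves
all such `H`.

The remaining work is to show that these tests run in polynomial time: closure properties of
polynomial-time functions (`PT`) and predicates (`PTP`) on trees, extraction of components by
repeated neighbourhood expansion (`PT.components`), and the polynomial relation between the size of
a graph and that of its encoding. -/

/-! ### Executing WHILE programs inside larger programs -/

/-- Number of nodes of a binary tree. -/
def Data.size : Data → ℕ
  | .nil => 1
  | .cons a b => a.size + b.size + 1

/-- All variables of the expression are below this number. -/
def Expr.bnd : Expr → ℕ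
  | .var x => x + 1
  | .nil => 0
  | .cons a b => max a.bnd b.bnd
  | .hd a => a.bnd
  | .tl a => a.bnd

/-- All variables of the command are below this number. -/
def Cmd.bnd : Cmd → ℕ
  | .assign x e => max (x + 1) e.bnd
  | .seq c d => max c.bnd d.bnd
  | .ite e c d => max e.bnd (max c.bnd d.bnd)
  | .loop e c => max e.bnd c.bnd

theorem Expr.eval_congr {e : Expr} {N : ℕ} {s s' : Store} (hN : e.bnd ≤ N)
    (h : ∀ i < N, s i = s' i) : e.eval s = e.eval s' := by
  induction e with
  | var x => exact h x hN
  | nil => rfl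
  | cons a b iha ihb =>
    have := max_le_iff.1 hN
    simp [eval, iha this.1, ihb this.2]
  | hd a ih => simp [eval, ih hN]
  | tl a ih => simp [eval, ih hN]

/-- A run reads and writes only the variables below `c.bnd`. Variables above can therefore store
data while `c` is executed as a subroutine. -/
theorem Exec.frame {c : Cmd} {s t : Store} {n : ℕ} (h : Exec c s t n) :
    ∀ {N : ℕ} {s' : Store}, c.bnd ≤ N → (∀ i < N, s i = s' i) →
      ∃ t', Exec c s' t' n ∧ (∀ i < N, t i = t' i) ∧ ∀ i, N ≤ i → t' i = s' i := by
  induction h with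
  | assign x e s =>
    intro N s' hN hs
    have := max_le_iff.1 hN
    refine ⟨_, Exec.assign x e s', fun i hi => ?_, fun i hi => ?_⟩
    · simp only [Function.update_apply, Expr.eval_congr this.2 hs, hs i hi]
    · rw [Function.update_of_ne]; omega
  | seq _ _ ih1 ih2 =>
    intro N s' hN hs
    have := max_le_iff.1 hN
    obtain ⟨t', h1, h2, h3⟩ := ih1 this.1 hs
    obtain ⟨u', h4, h5, h6⟩ := ih2 this.2 h2
    exact ⟨u', h1.seq h4, h5, fun i hi => (h6 i hi).trans (h3 i hi)⟩
  | ite_true he _ ih =>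
    intro N s' hN hs
    simp only [Cmd.bnd, max_le_iff] at hN
    obtain ⟨t', h1, h2, h3⟩ := ih hN.2.1 hs
    exact ⟨t', Exec.ite_true (Expr.eval_congr hN.1 hs ▸ he) h1, h2, h3⟩
  | ite_false he _ ih =>
    intro N s' hN hs
    simp only [Cmd.bnd, max_le_iff] at hN
    obtain ⟨t', h1, h2, h3⟩ := ih hN.2.2 hs
    exact ⟨t', Exec.ite_false (Expr.eval_congr hN.1 hs ▸ he) h1, h2, h3⟩
  | loop_done he =>
    intro N s' hN hs
    simp only [Cmd.bnd, max_le_iff] at hN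
    exact ⟨s', Exec.loop_done (Expr.eval_congr hN.1 hs ▸ he), hs, fun _ _ => rfl⟩
  | loop_step he _ _ ih1 ih2 =>
    intro N s' hN hs
    have hN' := hN
    simp only [Cmd.bnd, max_le_iff] at hN
    obtain ⟨t', h1, h2, h3⟩ := ih1 hN.2 hs
    obtain ⟨u', h4, h5, h6⟩ := ih2 hN' h2
    exact ⟨u', Exec.loop_step (Expr.eval_congr hN.1 hs ▸ he) h1 h4, h5,
      fun i hi => (h6 i hi).trans (h3 i hi)⟩

theorem Exec.eq_of_bnd_le {c : Cmd} {s t : Store} {n : ℕ} (h : Exec c s t n) {i : ℕ}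
    (hi : c.bnd ≤ i) : t i = s i := by
  induction h with
  | assign x e s =>
    have := max_le_iff.1 hi
    rw [Function.update_of_ne]; omega
  | seq _ _ ih1 ih2 =>
    have := max_le_iff.1 hi
    rw [ih2 this.2, ih1 this.1]
  | ite_true he _ ih => simp only [Cmd.bnd, max_le_iff] at hi; exact ih hi.2.1
  | ite_false he _ ih => simp only [Cmd.bnd, max_le_iff] at hi; exact ih hi.2.2
  | loop_done he => rfl
  | loop_step he _ _ ih1 ih2 =>
    have hi' := hi
    simp only [Cmd.bnd, max_le_iff] at hi'
    rw [ih2 hi, ih1 hi'.2]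

theorem Exec.congr_store {c : Cmd} {s t t' : Store} {n : ℕ} (h : Exec c s t n)
    (ht : ∀ i, t' i = t i) : Exec c s t' n :=
  funext ht ▸ h

/-- The program `p` transforms the value `a` of variable `0` into `b` within `T` steps, all other
variables being `nil` before and after. -/
def Cmd.Runs (p : Cmd) (a b : Data) (T : ℕ) : Prop :=
  ∃ n ≤ T, Exec p (Store.init a) (Store.init b) n

namespace Cmd

theorem Runs.exec_store {p : Cmd} {a b : Data} {T : ℕ} (h : p.Runs a b T) {N : ℕ}
    (hN : p.bnd ≤ N) {s : Store} (h0 : s 0 = a) (hs : ∀ i, 0 < i → i < N → s i = Data.nil) :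
    ∃ n ≤ T, Exec p s (Function.update s 0 b) n := by
  obtain ⟨n, hn, h⟩ := h
  have key : ∀ i < N, Store.init a i = s i := by
    intro i hi
    rcases Nat.eq_zero_or_pos i with rfl | h'
    · simp [Store.init, h0]
    · rw [hs i h' hi, Store.init, Function.update_of_ne h'.ne']
  obtain ⟨t', h1, h2, h3⟩ := h.frame hN key
  refine ⟨n, hn, ?_⟩
  convert h1 using 1
  funext i
  rcases lt_or_ge i N with hi | hi
  · rw [← h2 i hi]
    rcases Nat.eq_zero_or_pos i with rfl | h'
    · simp [Store.init]
    · rw [Function.update_of_ne h'.ne', ← key i hi, Store.init, Store.init,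
        Function.update_of_ne h'.ne', Function.update_of_ne h'.ne']
  · rw [h3 i hi]
    rcases Nat.eq_zero_or_pos i with rfl | h'
    · have hN0 : N = 0 := by omega
      subst hN0
      have h4 : Store.init b 0 = Store.init a 0 :=
        Exec.eq_of_bnd_le h (by omega)
      simpa [Store.init, h0] using h4
    · rw [Function.update_of_ne h'.ne']

theorem Runs.mono {p : Cmd} {a b : Data} {T T' : ℕ} (h : p.Runs a b T) (hT : T ≤ T') :
    p.Runs a b T' := by
  obtain ⟨n, hn, h⟩ := h
  exact ⟨n, hn.trans hT, h⟩

theorem Runs.seq {p q : Cmd} {a b d : Data} {T T' : ℕ} (h : p.Runs a b T) (h' : q.Runs b d T') :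
    (Cmd.seq p q).Runs a d (T + T') := by
  obtain ⟨n, hn, h⟩ := h
  obtain ⟨n', hn', h'⟩ := h'
  exact ⟨n + n', by omega, Exec.seq h h'⟩

theorem runs_assign (e : Expr) (a : Data) :
    (Cmd.assign 0 e).Runs a (e.eval (Store.init a)) (e.cost + 1) := by
  refine ⟨_, le_rfl, ?_⟩
  have := Exec.assign 0 e (Store.init a)
  simpa [Store.init] using this

theorem Runs.ite {p q : Cmd} {a b : Data} {T : ℕ} (e : Expr)
    (h : e.eval (Store.init a) ≠ Data.nil → p.Runs a b T)
    (h' : e.eval (Store.init a) = Data.nil → q.Runs a b T) :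
    (Cmd.ite e p q).Runs a b (e.cost + 1 + T) := by
  by_cases he : e.eval (Store.init a) = Data.nil
  · obtain ⟨n, hn, h'⟩ := h' he
    exact ⟨_, by omega, Exec.ite_false he h'⟩
  · obtain ⟨n, hn, h⟩ := h he
    exact ⟨_, by omega, Exec.ite_true he h⟩

/-- Apply `p` to the first component of the value of variable `0`. -/
def first (p : Cmd) : Cmd :=
  -- A variable out of reach of `p`; the `+ 1` makes it visibly different from variable `0`.
  let N := p.bnd + 1
  .seq (.assign N (.tl (.var 0))) (.seq (.assign 0 (.hd (.var 0)))
    (.seq p (.seq (.assign 0 (.cons (.var 0) (.var N))) (.assign N .nil))))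

theorem Runs.first {p : Cmd} {a b : Data} {T : ℕ} (h : p.Runs a b T) (d : Data) :
    p.first.Runs (Data.cons a d) (Data.cons b d) (T + 12) := by
  have hN : p.bnd + 1 ≠ 0 := by omega
  set s1 := Function.update (Store.init (Data.cons a d)) (p.bnd + 1) d with hs1
  set s2 := Function.update s1 0 a with hs2
  obtain ⟨n, hn, hx⟩ := h.exec_store le_rfl (s := s2) (by simp [hs2]) (by
    intro i hi hi'
    rw [hs2, Function.update_of_ne hi.ne', hs1, Function.update_of_ne (by omega), Store.init,
      Function.update_of_ne hi.ne'])
  -- The costs of the four assignments around `p`; they add up to 12.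
  refine ⟨3 + (3 + (n + (4 + 2))), by omega, ?_⟩
  have e1 := Exec.assign (p.bnd + 1) (.tl (.var 0)) (Store.init (Data.cons a d))
  have e2 := Exec.assign 0 (.hd (.var 0)) s1
  have e3 := Exec.assign 0 (.cons (.var 0) (.var (p.bnd + 1))) (Function.update s2 0 b)
  have e4 := Exec.assign (p.bnd + 1) .nil
    (Function.update (Function.update s2 0 b) 0 (Data.cons b d))
  refine Exec.seq (t := s1) ?_ (Exec.seq (t := s2) ?_ (Exec.seq hx (Exec.seq
    (t := Function.update (Function.update s2 0 b) 0 (Data.cons b d)) ?_ ?_)))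
  · simpa [Expr.eval, Store.init, Data.tl, Expr.cost, hs1] using e1
  · simpa [Expr.eval, Store.init, Data.hd, Expr.cost, hs1, hs2] using e2
  · simpa [Expr.eval, Store.init, Data.hd, Expr.cost, hs1, hs2] using e3
  · refine e4.congr_store fun i => ?_
    simp only [Store.init, Function.update_apply, Expr.eval, hs1, hs2]
    split_ifs <;> simp_all

/-- Fold `p` over a list: the value of variable `0` is the pair of the initial state and the
list. -/
def fold (p : Cmd) : Cmd :=
  let N := p.bnd + 1
  .seq (.assign N (.tl (.var 0))) (.seq (.assign 0 (.hd (.var 0)))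
    (.loop (.var N) (.seq (.assign 0 (.cons (.var 0) (.hd (.var N))))
      (.seq p (.assign N (.tl (.var N)))))))

/-- The loop keeps the state in variable `0` and the rest of the list in a variable that `p` does
not touch. The body has to be fast only on states reached from prefixes of `l`, so `K` may depend on
a size bound for these states. -/
theorem Runs.fold {σ α : Type*} {p : Cmd} (es : σ → Data) (ea : α → Data) (step : σ → α → σ)
    (K : ℕ) (l : List α) (s : σ)
    (h : ∀ l₁ x l₂, l = l₁ ++ x :: l₂ →
      p.Runs (Data.cons (es (l₁.foldl step s)) (ea x)) (es (step (l₁.foldl step s) x)) K) :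
    p.fold.Runs (Data.cons (es s) (Data.ofList (l.map ea))) (es (l.foldl step s))
      (l.length * (K + 10) + 8) := by
  have hN : p.bnd + 1 ≠ 0 := by omega
  let st : Data → Data → Store := fun a d => Function.update (Store.init a) (p.bnd + 1) d
  have loop : ∀ (l : List α) (s : σ), (∀ l₁ x l₂, l = l₁ ++ x :: l₂ →
      p.Runs (Data.cons (es (l₁.foldl step s)) (ea x)) (es (step (l₁.foldl step s) x)) K) →
      ∃ n ≤ l.length * (K + 10) + 2, Exec (.loop (.var (p.bnd + 1))
        (.seq (.assign 0 (.cons (.var 0) (.hd (.var (p.bnd + 1)))))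
          (.seq p (.assign (p.bnd + 1) (.tl (.var (p.bnd + 1)))))))
        (st (es s) (Data.ofList (l.map ea))) (st (es (l.foldl step s)) Data.nil) n := by
    intro l
    induction l with
    | nil =>
      intro s _
      exact ⟨2, by simp, Exec.loop_done (by simp [Expr.eval, st, Data.ofList])⟩
    | cons x l ih =>
      intro s h
      obtain ⟨n, hn, hx⟩ := ih (step s x) (fun l₁ y l₂ e => by
        simpa using h (x :: l₁) y l₂ (by simp [e]))
      have h0 := h [] x l rfl
      simp only [List.foldl_nil] at h0
      set S := Data.ofList ((x :: l).map ea) with hS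
      obtain ⟨m, hm, hp⟩ := h0.exec_store le_rfl
        (s := st (Data.cons (es s) (ea x)) S) (by simp [st, Store.init])
        (fun i hi hi' => by
          simp only [st]
          rw [Function.update_of_ne (by omega), Store.init, Function.update_of_ne hi.ne'])
      -- One round costs 2 for the test, 5 and 3 for the two assignments, and `m` for `p`: hence `K
      -- + 10`.
      refine ⟨1 + 1 + (5 + (m + 3)) + n, by simp only [List.length_cons]; linarith, ?_⟩
      have e1 := Exec.assign 0 (.cons (.var 0) (.hd (.var (p.bnd + 1)))) (st (es s) S)
      have e2 := Exec.assign (p.bnd + 1) (.tl (.var (p.bnd + 1)))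
        (Function.update (st (Data.cons (es s) (ea x)) S) 0 (es (step s x)))
      refine Exec.loop_step ?_ (Exec.seq (t := st (Data.cons (es s) (ea x)) S) ?_
        (Exec.seq hp ?_)) hx
      · simp [Expr.eval, st, hS, Data.ofList]
      · refine e1.congr_store fun i => ?_
        simp only [st, Store.init, Function.update_apply, Expr.eval, hS, Data.ofList, Data.hd,
          List.map_cons]
        split_ifs <;> simp_all
      · refine e2.congr_store fun i => ?_
        simp only [st, Store.init, Function.update_apply, Expr.eval, hS, Data.ofList, Data.tl,
          List.map_cons]
        split_ifs <;> simp_all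
  obtain ⟨n, hn, hl⟩ := loop l s h
  refine ⟨3 + (3 + n), by omega, ?_⟩
  set S := Data.ofList (l.map ea)
  have e1 := Exec.assign (p.bnd + 1) (.tl (.var 0)) (Store.init (Data.cons (es s) S))
  have e2 := Exec.assign 0 (.hd (.var 0)) (st (Data.cons (es s) S) S)
  have e3 : st (es (l.foldl step s)) Data.nil = Store.init (es (l.foldl step s)) := by
    funext i
    simp only [st, Store.init, Function.update_apply]
    split_ifs <;> simp_all
  rw [← e3]
  refine Exec.seq (t := st (Data.cons (es s) S) S) ?_ (Exec.seq ?_ hl)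
  · simpa [Expr.eval, Store.init, Data.tl, Expr.cost, st] using e1
  · refine e2.congr_store fun i => ?_
    simp only [st, Store.init, Function.update_apply, Expr.eval, Data.hd]
    split_ifs <;> simp_all

/-- Reset the variables `1, …, n` to `nil`. -/
def clear : ℕ → Cmd
  -- The language has no empty command; this assignment plays its role.
  | 0 => .assign 0 (.var 0)
  | n + 1 => .seq (clear n) (.assign (n + 1) .nil)

theorem exec_clear (N : ℕ) (s : Store) :
    Exec (clear N) s (fun i => if 0 < i ∧ i ≤ N then Data.nil else s i) (2 * N + 2) := by
  induction N with
  | zero =>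
    refine (Exec.assign 0 (.var 0) s).congr_store fun i => ?_
    simp only [Function.update_apply, Expr.eval]
    split_ifs <;> simp_all
  | succ n ih =>
    have h := Exec.assign (n + 1) .nil (fun i => if 0 < i ∧ i ≤ n then Data.nil else s i)
    refine (ih.seq h).congr_store fun i => ?_
    simp only [Function.update_apply, Expr.eval]
    split_ifs <;> first | rfl | omega

/-- Run the decision program `p` and normalize its answer. -/
def normalize (p : Cmd) : Cmd :=
  .seq (.seq p (clear p.bnd))
    (.ite (.var 0) (.assign 0 (.cons .nil .nil)) (.assign 0 .nil))

/-- A decider may leave arbitrary values behind, but only in variables below `p.bnd`. Clearing these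
restores the convention of `Runs`, so that the decider becomes a subroutine. -/
theorem DecidesWithin.runs_normalize {p : Cmd} {a : Data} {P : Prop} {T : ℕ}
    (h : p.DecidesWithin a P T) (b : Data) (hb : P → b = Data.cons Data.nil Data.nil)
    (hb' : ¬ P → b = Data.nil) : p.normalize.Runs a b (T + (2 * p.bnd + 10)) := by
  obtain ⟨t, n, h, hn, ht⟩ := h
  have e1 := exec_clear p.bnd t
  have e2 : (fun i => if 0 < i ∧ i ≤ p.bnd then Data.nil else t i) = Store.init (t 0) := by
    funext i
    rcases Nat.eq_zero_or_pos i with rfl | hi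
    · simp [Store.init]
    · rw [Store.init, Function.update_of_ne hi.ne']
      split_ifs with hc
      · rfl
      · rw [h.eq_of_bnd_le (by omega), Store.init, Function.update_of_ne hi.ne']
  rw [e2] at e1
  have r1 : (Cmd.seq p (clear p.bnd)).Runs a (t 0) (T + (2 * p.bnd + 2)) :=
    ⟨n + (2 * p.bnd + 2), by omega, h.seq e1⟩
  have r2 : (Cmd.ite (.var 0) (.assign 0 (.cons .nil .nil)) (.assign 0 .nil)).Runs (t 0) b
      (1 + 1 + 4) := by
    refine Runs.ite (.var 0) (fun h0 => ?_) (fun h0 => ?_)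
    · rw [hb (ht.1 (by simpa [Expr.eval, Store.init] using h0))]
      exact runs_assign _ _
    · rw [hb' (fun hP => ht.2 hP (by simpa [Expr.eval, Store.init] using h0))]
      exact (runs_assign .nil _).mono (by simp [Expr.cost])
  exact (r1.seq r2).mono (by omega)

end Cmd

/-! ### Polynomial bounds -/

/-- `u` is bounded by a polynomial in `v`. -/
def PolyLe {α : Type*} (u v : α → ℕ) : Prop := ∃ c : ℕ, ∀ a, u a ≤ (v a + 2) ^ c

namespace PolyLe

variable {α β : Type*} {u v w : α → ℕ}

theorem of_le (h : ∀ a, u a ≤ v a) : PolyLe u v :=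
  ⟨1, fun a => by rw [pow_one]; exact (h a).trans (Nat.le_add_right _ _)⟩

theorem refl (u : α → ℕ) : PolyLe u u := of_le fun _ => le_rfl

theorem const (k : ℕ) (v : α → ℕ) : PolyLe (fun _ => k) v :=
  -- The base `v a + 2` is at least 2, so an exponent can absorb constants.
  ⟨k, fun a => (Nat.lt_two_pow_self).le.trans (Nat.pow_le_pow_left (by omega) k)⟩

theorem mono (h : PolyLe v w) (h' : ∀ a, u a ≤ v a) : PolyLe u w := by
  obtain ⟨c, hc⟩ := h
  exact ⟨c, fun a => (h' a).trans (hc a)⟩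

theorem add (h : PolyLe u w) (h' : PolyLe v w) : PolyLe (fun a => u a + v a) w := by
  obtain ⟨c, hc⟩ := h
  obtain ⟨d, hd⟩ := h'
  refine ⟨c + d + 1, fun a => ?_⟩
  have h1 : (w a + 2) ^ c ≤ (w a + 2) ^ (c + d) := Nat.pow_le_pow_right (by omega) (by omega)
  have h2 : (w a + 2) ^ d ≤ (w a + 2) ^ (c + d) := Nat.pow_le_pow_right (by omega) (by omega)
  have h3 : (w a + 2) ^ (c + d) * 2 ≤ (w a + 2) ^ (c + d + 1) := by
    rw [pow_succ]; exact Nat.mul_le_mul_left _ (by omega)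
  have := hc a
  have := hd a
  simp only
  omega

theorem mul (h : PolyLe u w) (h' : PolyLe v w) : PolyLe (fun a => u a * v a) w := by
  obtain ⟨c, hc⟩ := h
  obtain ⟨d, hd⟩ := h'
  exact ⟨c + d, fun a => by rw [pow_add]; exact Nat.mul_le_mul (hc a) (hd a)⟩

theorem trans (h : PolyLe u v) (h' : PolyLe v w) : PolyLe u w := by
  obtain ⟨c, hc⟩ := h
  obtain ⟨d, hd⟩ := h'
  refine ⟨(d + 2) * c, fun a => (hc a).trans ?_⟩
  rw [pow_mul]
  refine Nat.pow_le_pow_left ?_ c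
  -- The summand `+ 2` of the new base is paid for by a factor 4, which two more exponents provide.
  have h1 : (w a + 2) ^ d * 4 ≤ (w a + 2) ^ (d + 2) := by
    rw [pow_add]; exact Nat.mul_le_mul_left _ (by ring_nf; omega)
  have h2 : 0 < (w a + 2) ^ d := by positivity
  have := hd a
  omega

theorem pow (h : PolyLe u w) (c : ℕ) : PolyLe (fun a => (u a + 2) ^ c) w :=
  trans ⟨c, fun _ => le_rfl⟩ h

theorem comp (h : PolyLe u v) (g : β → α) : PolyLe (fun b => u (g b)) (fun b => v (g b)) := by
  obtain ⟨c, hc⟩ := h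
  exact ⟨c, fun b => hc (g b)⟩

/-- The single number `3 ^ c` serves as factor, since `v + 2 ≤ 3 * v` for positive `v`, as exponent,
since it is at least `c`, and as the summand that handles `v = 0`. -/
theorem exists_mul_pow_add (h : PolyLe u v) : ∃ k, ∀ a, u a ≤ k * v a ^ k + k := by
  obtain ⟨c, hc⟩ := h
  have hck : c ≤ 3 ^ c := (Nat.lt_pow_self (by norm_num)).le
  refine ⟨3 ^ c, fun a => (hc a).trans ?_⟩
  rcases Nat.eq_zero_or_pos (v a) with h0 | h0
  · rw [h0]
    have : (0 + 2) ^ c ≤ 3 ^ c := Nat.pow_le_pow_left (by norm_num) c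
    omega
  · have h1 : (v a + 2) ^ c ≤ (3 * v a) ^ c := Nat.pow_le_pow_left (by omega) c
    have h2 : v a ^ c ≤ v a ^ 3 ^ c := Nat.pow_le_pow_right h0 hck
    rw [mul_pow] at h1
    have h3 := Nat.mul_le_mul_left (3 ^ c) h2
    omega

theorem exists_mul_succ_pow (h : PolyLe u v) : ∃ k c, ∀ a, u a ≤ k * (v a + 1) ^ c := by
  obtain ⟨c, hc⟩ := h
  refine ⟨2 ^ c, c, fun a => (hc a).trans ?_⟩
  rw [← mul_pow]
  exact Nat.pow_le_pow_left (by omega) c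

theorem of_mul_pow_add (h : PolyLe v w) (k : ℕ) : PolyLe (fun a => k * v a ^ k + k) w := by
  refine ((const k w).mul (mono (h.pow k) fun a => ?_)).add (const k w)
  exact Nat.pow_le_pow_left (by omega) k

end PolyLe

/-! ### Polynomial-time functions between encoded types -/

/-- Types whose elements are represented by binary trees. -/
class Enc (α : Type) where
  /-- the representation -/
  enc : α → Data

open Enc

/-- The size of the representation. -/
def sz {α : Type} [Enc α] (a : α) : ℕ := (enc a).size

instance : Enc Data := ⟨id⟩
instance : Enc ℕ := ⟨Data.ofNat⟩
instance : Enc Unit := ⟨fun _ => Data.nil⟩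
instance : Enc Bool := ⟨fun b => if b then Data.cons Data.nil Data.nil else Data.nil⟩
instance {α β : Type} [Enc α] [Enc β] : Enc (α × β) := ⟨fun x => Data.cons (enc x.1) (enc x.2)⟩
instance {α : Type} [Enc α] : Enc (List α) := ⟨fun l => Data.ofList (l.map enc)⟩
instance : Enc InputGraph := ⟨InputGraph.encode⟩

section sizes

variable {α β : Type} [Enc α] [Enc β]

theorem sz_prod (a : α) (b : β) : sz (a, b) = sz a + sz b + 1 := rfl

@[simp] theorem sz_nil : sz ([] : List α) = 1 := rfl

@[simp] theorem sz_cons (a : α) (l : List α) : sz (a :: l) = sz a + sz l + 1 := rfl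

theorem sz_nat (n : ℕ) : sz n = 2 * n + 1 := by
  induction n with
  | zero => rfl
  | succ n ih =>
    have : sz (n + 1) = 1 + sz n + 1 := rfl
    omega

theorem sz_bool_le (b : Bool) : sz b ≤ 3 := by
  cases b <;> simp [sz, enc, Data.size]

theorem sz_le_of_mem {l : List α} {a : α} (h : a ∈ l) : sz a ≤ sz l := by
  induction l with
  | nil => simp at h
  | cons b l ih =>
    rw [sz_cons]
    rcases List.mem_cons.1 h with rfl | h
    · omega
    · have := ih h; omega

theorem sz_le_of_sublist {l l' : List α} (h : l.Sublist l') : sz l ≤ sz l' := by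
  induction h with
  | slnil => rfl
  | cons a _ ih => rw [sz_cons]; omega
  | cons_cons a _ ih => rw [sz_cons, sz_cons]; omega

theorem length_lt_sz (l : List α) : l.length < sz l := by
  induction l with
  | nil => simp
  | cons a l ih => rw [sz_cons, List.length_cons]; omega

theorem sz_list_le {l : List α} {M : ℕ} (h : ∀ a ∈ l, sz a ≤ M) :
    sz l ≤ l.length * (M + 1) + 1 := by
  induction l with
  | nil => simp
  | cons a l ih =>
    have h1 := h a (by simp)
    have h2 := ih fun b hb => h b (by simp [hb])
    rw [sz_cons, List.length_cons]
    linarith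

end sizes

/-- Functions that are computed by a program in polynomial time, with values of polynomial size. -/
def PT {α β : Type} [Enc α] [Enc β] (f : α → β) : Prop :=
  ∃ (p : Cmd) (T : α → ℕ), (∀ a, p.Runs (enc a) (enc (f a)) (T a)) ∧ PolyLe T sz ∧
    -- The time bound does not imply this: pairing a value with itself has constant cost and more
    -- than doubles the tree.
    PolyLe (fun a => sz (f a)) sz

open Classical in
/-- Predicates that are decided by a program in polynomial time. -/
def PTP {α : Type} [Enc α] (P : α → Prop) : Prop := PT fun a => decide (P a)

namespace PT

variable {α β γ σ : Type} [Enc α] [Enc β] [Enc γ] [Enc σ]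

theorem of_expr {f : α → β} (e : Expr) (h : ∀ a, e.eval (Store.init (enc a)) = enc (f a))
    (hs : PolyLe (fun a => sz (f a)) sz) : PT f :=
  ⟨.assign 0 e, fun _ => e.cost + 1, fun a => h a ▸ Cmd.runs_assign e (enc a), .const _ _, hs⟩

theorem of_enc_eq {f : α → β} (h : ∀ a, enc (f a) = enc a) : PT f :=
  of_expr (.var 0) (fun a => by simp [Expr.eval, Store.init, h])
    (.of_le fun a => by simp [sz, h])

/-- Programs see only encodings, so types with the same encodings can be exchanged: a number for a
list of units, an input graph for a number with a list of pairs. -/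
theorem congr_enc {f : α → β} {g : α → γ} (hf : PT f) (h : ∀ a, enc (g a) = enc (f a)) : PT g := by
  obtain ⟨p, T, hp, hT, hs⟩ := hf
  exact ⟨p, T, fun a => h a ▸ hp a, hT, by simpa [sz, h] using hs⟩

theorem comp {g : β → γ} {f : α → β} (hg : PT g) (hf : PT f) : PT fun a => g (f a) := by
  obtain ⟨p, T, hp, hT, hs⟩ := hf
  obtain ⟨q, U, hq, hU, hr⟩ := hg
  exact ⟨.seq p q, fun a => T a + U (f a), fun a => (hp a).seq (hq (f a)),
    hT.add ((hU.comp f).trans hs), (hr.comp f).trans hs⟩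

theorem id : PT fun a : α => a := of_enc_eq fun _ => rfl

/-- The expression with a given value. -/
def constExpr : Data → Expr
  | .nil => .nil
  | .cons a b => .cons (constExpr a) (constExpr b)

theorem eval_constExpr (d : Data) (s : Store) : (constExpr d).eval s = d := by
  induction d with
  | nil => rfl
  | cons a b iha ihb => simp [constExpr, Expr.eval, iha, ihb]

theorem const (b : β) : PT fun _ : α => b :=
  of_expr (constExpr (enc b)) (fun _ => eval_constExpr _ _) (.const _ _)

theorem fst {f : γ → α × β} (hf : PT f) : PT fun g => (f g).1 :=
  comp (g := Prod.fst) (of_expr (.hd (.var 0)) (fun _ => rfl)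
    (.of_le fun a => by rw [← Prod.mk.eta (p := a), sz_prod]; simp only; omega)) hf

theorem snd {f : γ → α × β} (hf : PT f) : PT fun g => (f g).2 :=
  comp (g := Prod.snd) (of_expr (.tl (.var 0)) (fun _ => rfl)
    (.of_le fun a => by rw [← Prod.mk.eta (p := a), sz_prod]; simp only; omega)) hf

/-- The input is duplicated; `first` applies each program to one copy while the other is kept, and
swaps bring the copies into position. -/
theorem pair {f : γ → α} {g : γ → β} (hf : PT f) (hg : PT g) : PT fun x => (f x, g x) := by
  obtain ⟨p, T, hp, hT, hs⟩ := hf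
  obtain ⟨q, U, hq, hU, hr⟩ := hg
  let swap : Cmd := .assign 0 (.cons (.tl (.var 0)) (.hd (.var 0)))
  have hswap : ∀ a b : Data, swap.Runs (.cons a b) (.cons b a) 6 := fun a b =>
    Cmd.runs_assign (.cons (.tl (.var 0)) (.hd (.var 0))) (.cons a b)
  refine ⟨.seq (.assign 0 (.cons (.var 0) (.var 0))) (.seq p.first (.seq swap (.seq q.first swap))),
    fun x => 4 + (T x + 12 + (6 + (U x + 12 + 6))), fun x => ?_, ?_, ?_⟩
  · exact (Cmd.runs_assign (.cons (.var 0) (.var 0)) (enc x)).seq (((hp x).first (enc x)).seq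
      ((hswap _ _).seq (((hq x).first _).seq (hswap _ _))))
  · exact (PolyLe.const _ _).add ((hT.add (.const _ _)).add ((PolyLe.const _ _).add
      ((hU.add (.const _ _)).add (.const _ _))))
  · exact (hs.add hr).add (.const 1 _)

end PT

theorem PTP.congr {α : Type} [Enc α] {P Q : α → Prop} (hP : PTP P) (h : ∀ a, Q a ↔ P a) :
    PTP Q := by
  rwa [show Q = P from funext fun a => propext (h a)]

theorem PTP.enc_eq_nil {α β : Type} [Enc α] [Enc β] {f : α → β} (hf : PT f) :
    PTP fun a => enc (f a) = Data.nil := by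
  classical
  obtain ⟨p, T, hp, hT, hs⟩ := hf
  refine ⟨.seq p (.ite (.var 0) (.assign 0 .nil) (.assign 0 (.cons .nil .nil))),
    fun a => T a + (1 + 1 + 4), fun a => (hp a).seq ?_, hT.add (.const _ _),
    (PolyLe.const 3 _).mono fun a => sz_bool_le _⟩
  refine Cmd.Runs.ite (.var 0) (fun h => ?_) (fun h => ?_) <;>
    simp only [Expr.eval, Store.init, Function.update_self] at h
  · have h' := (Cmd.runs_assign .nil (enc (f a))).mono (T' := 4) (by simp [Expr.cost])
    simpa [h, enc, Expr.eval] using h'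
  · have h' := Cmd.runs_assign (.cons .nil .nil) (enc (f a))
    simpa [h, enc, Expr.eval, Expr.cost] using h'

namespace PT

variable {α β γ σ : Type} [Enc α] [Enc β] [Enc γ] [Enc σ]

theorem ite {P : γ → Prop} [DecidablePred P] {f g : γ → α} (hP : PTP P) (hf : PT f) (hg : PT g) :
    PT fun x => if P x then f x else g x := by
  obtain ⟨r, V, hr, hV, -⟩ := PT.pair hP PT.id
  obtain ⟨p, T, hp, hT, hs⟩ := hf
  obtain ⟨q, U, hq, hU, hs'⟩ := hg
  refine ⟨.seq r (.ite (.hd (.var 0)) (.seq (.assign 0 (.tl (.var 0))) p)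
    (.seq (.assign 0 (.tl (.var 0))) q)), fun x => V x + (2 + 1 + (3 + (T x + U x))),
    fun x => (hr x).seq ?_, hV.add ((PolyLe.const _ _).add ((PolyLe.const _ _).add (hT.add hU))),
    (hs.add hs').mono fun x => by beta_reduce; split_ifs <;> omega⟩
  have h3 := Cmd.runs_assign (.tl (.var 0)) (enc (@decide (P x) (Classical.propDecidable _), x))
  refine Cmd.Runs.ite (.hd (.var 0)) (fun h => ?_) (fun h => ?_) <;>
    simp only [Expr.eval, Store.init, Function.update_self, enc, Data.hd] at h
  · have h' : P x := by by_contra hc; simp [hc] at h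
    simp only [if_pos h']
    exact (h3.seq (hp x)).mono (by simp only [Expr.cost]; omega)
  · have h' : ¬ P x := by intro hc; simp [hc] at h
    simp only [if_neg h']
    exact (h3.seq (hq x)).mono (by simp only [Expr.cost]; omega)

/-- A polynomial-time step can double the state in every round, so a polynomial bound `B` on all
intermediate states has to be supplied. The program carries `g` along with the state because `step`
may depend on it. -/
theorem foldl {init : γ → σ} {l : γ → List α} {step : γ → σ → α → σ} (hi : PT init) (hl : PT l)
    (hs : PT fun x : (γ × σ) × α => step x.1.1 x.1.2 x.2) (B : γ → ℕ) (hB : PolyLe B sz)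
    (h : ∀ g l₁, l₁ <+: l g → sz (l₁.foldl (step g) (init g)) ≤ B g) :
    PT fun g => (l g).foldl (step g) (init g) := by
  obtain ⟨p, T, hp, hT, -⟩ := (PT.id.pair hi).pair hl
  obtain ⟨q, U, hq, ⟨c, hc⟩, -⟩ := (PT.id.fst.fst).pair hs
  obtain ⟨r, V, hr, hV, -⟩ := (PT.id (α := γ × σ)).snd
  obtain ⟨-, -, -, -, hls⟩ := hl
  let K : γ → ℕ := fun g => (sz g + B g + 1 + sz (l g) + 1 + 2) ^ c
  have hfold : ∀ g (l₁ : List α) (s : σ),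
      l₁.foldl (fun (s : γ × σ) x => (s.1, step s.1 s.2 x)) (g, s) = (g, l₁.foldl (step g) s) := by
    intro g l₁
    induction l₁ with
    | nil => intro s; rfl
    | cons x l₁ ih => intro s; exact ih _
  have h2 : ∀ g, q.fold.Runs (enc ((g, init g), l g)) (enc (g, (l g).foldl (step g) (init g)))
      ((l g).length * (K g + 10) + 8) := by
    intro g
    rw [← hfold]
    refine Cmd.Runs.fold (enc (α := γ × σ)) enc
      (fun (s : γ × σ) x => (s.1, step s.1 s.2 x)) (K g) (l g) (g, init g) ?_
    intro l₁ x l₂ e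
    rw [hfold]
    refine (hq ((g, l₁.foldl (step g) (init g)), x)).mono ((hc _).trans ?_)
    refine Nat.pow_le_pow_left ?_ c
    rw [sz_prod, sz_prod]
    have h3 := h g l₁ ⟨_, e.symm⟩
    have h4 : sz x ≤ sz (l g) := sz_le_of_mem (by rw [e]; simp)
    omega
  refine ⟨.seq p (.seq q.fold r),
    fun g => T g + ((l g).length * (K g + 10) + 8 + V (g, (l g).foldl (step g) (init g))),
    fun g => (hp g).seq ((h2 g).seq (hr _)), ?_, hB.mono fun g => h g _ (List.prefix_refl _)⟩
  refine hT.add ((((hls.mono fun g => (length_lt_sz _).le).mul (.add ?_ (.const _ _))).add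
    (.const _ _)).add ?_)
  · exact ((((PolyLe.refl _).add hB).add (.const 1 _)).add hls |>.add (.const 1 _)).pow c
  · refine (hV.comp _).trans ?_
    refine (((PolyLe.refl _).add hB).add (.const 1 _)).mono fun g => ?_
    rw [sz_prod]
    have := h g _ (List.prefix_refl _)
    omega

theorem bool_not {b : γ → Bool} (hb : PT b) : PT fun g => !(b g) := by
  have h : PTP fun g => enc (b g) = Data.nil := PTP.enc_eq_nil hb
  refine PT.congr_enc h fun g => ?_
  cases hg : b g <;> simp [enc, hg]

end PT

/-! ### Boolean combinations of polynomial-time predicates -/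

namespace PTP

variable {α β γ σ : Type} [Enc α] [Enc β] [Enc γ] [Enc σ]

theorem comp {P : α → Prop} (hP : PTP P) {f : γ → α} (hf : PT f) : PTP fun g => P (f g) :=
  PT.comp hP hf

theorem not {P : γ → Prop} (hP : PTP P) : PTP fun g => ¬ P g := by
  classical
  exact (PT.bool_not hP).congr_enc fun g => by by_cases h : P g <;> simp [h]

theorem const (P : Prop) : PTP fun _ : γ => P := PT.const _

theorem and {P Q : γ → Prop} (hP : PTP P) (hQ : PTP Q) : PTP fun g => P g ∧ Q g := by
  classical
  exact (PT.ite hP hQ (PT.const false)).congr_enc fun g => by by_cases h : P g <;> simp [h]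

theorem or {P Q : γ → Prop} (hP : PTP P) (hQ : PTP Q) : PTP fun g => P g ∨ Q g :=
  (hP.not.and hQ.not).not.congr fun g => by tauto

theorem forall_finset {ι : Type*} {P : ι → γ → Prop} (s : Finset ι) (h : ∀ i ∈ s, PTP (P i)) :
    PTP fun g => ∀ i ∈ s, P i g := by
  classical
  induction s using Finset.induction_on with
  | empty => exact (const True).congr fun g => by simp
  | insert i s _ ih =>
    exact ((h i (by simp)).and (ih fun j hj => h j (by simp [hj]))).congr fun g => by simp

theorem exists_finset {ι : Type*} {P : ι → γ → Prop} (s : Finset ι) (h : ∀ i ∈ s, PTP (P i)) :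
    PTP fun g => ∃ i ∈ s, P i g :=
  (forall_finset s fun i hi => (h i hi).not).not.congr fun g => by push Not; rfl

end PTP

/-! ### Operations on numbers and lists -/

namespace PT

variable {α β γ σ : Type} [Enc α] [Enc β] [Enc γ] [Enc σ]

theorem data {f : γ → α} (hf : PT f) : PT fun g => enc (f g) := hf.congr_enc fun _ => rfl

theorem data_hd {f : γ → Data} (hf : PT f) : PT fun g => (f g).hd :=
  comp (g := Data.hd) (of_expr (.hd (.var 0)) (fun _ => rfl) (.of_le fun a => by
    cases a <;> simp [sz, enc, Data.hd, Data.size]; omega)) hf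

theorem data_tl {f : γ → Data} (hf : PT f) : PT fun g => (f g).tl :=
  comp (g := Data.tl) (of_expr (.tl (.var 0)) (fun _ => rfl) (.of_le fun a => by
    cases a <;> simp [sz, enc, Data.tl, Data.size]; omega)) hf

theorem cons {f : γ → α} {l : γ → List α} (hf : PT f) (hl : PT l) : PT fun g => f g :: l g :=
  (hf.pair hl).congr_enc fun _ => rfl

theorem succ {n : γ → ℕ} (hn : PT n) : PT fun g => n g + 1 :=
  ((PT.const ()).pair hn).congr_enc fun _ => rfl

theorem pred {n : γ → ℕ} (hn : PT n) : PT fun g => n g - 1 :=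
  hn.data.data_tl.congr_enc fun g => by cases n g <;> rfl

theorem tail {l : γ → List α} (hl : PT l) : PT fun g => (l g).tail :=
  hl.data.data_tl.congr_enc fun g => by cases l g <;> rfl

theorem headD_zero {l : γ → List ℕ} (hl : PT l) : PT fun g => (l g).headD 0 :=
  hl.data.data_hd.congr_enc fun g => by cases l g <;> rfl

/-- Unary numbers are lists of units, which turns an `n`-fold iteration into a fold over a list. -/
theorem enc_nat_eq (n : ℕ) : enc n = enc (List.replicate n ()) := by
  induction n with
  | zero => rfl
  | succ n ih =>
    change Data.cons Data.nil (enc n) = Data.cons Data.nil (enc (List.replicate n ()))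
    rw [ih]

theorem iterate {n : γ → ℕ} {init : γ → σ} {f : γ → σ → σ} (hn : PT n) (hi : PT init)
    (hf : PT fun x : γ × σ => f x.1 x.2) (B : γ → ℕ) (hB : PolyLe B sz)
    (h : ∀ g, ∀ j ≤ n g, sz ((f g)^[j] (init g)) ≤ B g) : PT fun g => (f g)^[n g] (init g) := by
  have hl : PT fun g => List.replicate (n g) () := hn.congr_enc fun g => (enc_nat_eq _).symm
  have := foldl (step := fun g s _ => f g s) hi hl (hf.comp PT.id.fst) B hB (fun g l₁ h' => by
    rw [List.foldl_const]
    exact h g _ (by simpa using h'.length_le))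
  exact this.congr_enc fun g => by rw [List.foldl_const, List.length_replicate]

theorem reverse {l : γ → List α} (hl : PT l) : PT fun g => (l g).reverse := by
  have := foldl (step := fun _ acc x => x :: acc) (PT.const ([] : List α)) hl
    (PT.id.snd.cons PT.id.fst.snd) (fun g => sz (l g) * (sz (l g) + 1) + 1)
    (by
      obtain ⟨-, -, -, -, hs⟩ := hl
      exact (hs.mul (hs.add (.const _ _))).add (.const _ _))
    (fun g l₁ h => by
      rw [List.foldl_flip_cons_eq_append, List.append_nil, List.map_id']
      refine (sz_list_le (M := sz (l g)) fun a ha => sz_le_of_mem (h.subset (by simpa using ha))).trans ?_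
      have h1 := h.length_le
      have h2 := length_lt_sz (l g)
      rw [List.length_reverse]
      gcongr
      omega)
  exact this.congr_enc fun g => by
    rw [List.foldl_flip_cons_eq_append, List.append_nil, List.map_id']

theorem map {l : γ → List α} {f : γ → α → β} (hl : PT l) (hf : PT fun x : γ × α => f x.1 x.2) :
    PT fun g => (l g).map (f g) := by
  obtain ⟨c, hc⟩ := hf.choose_spec.choose_spec.2.2
  have hs := hl.choose_spec.choose_spec.2.2
  have e : ∀ g (l₁ : List α), l₁.foldl (fun acc x => f g x :: acc) [] = (l₁.map (f g)).reverse := by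
    intro g l₁
    rw [List.foldl_flip_cons_eq_append, List.append_nil]
  have := foldl (step := fun g acc x => f g x :: acc) (PT.const ([] : List β)) hl
    ((hf.comp (PT.id.fst.fst.pair PT.id.snd)).cons PT.id.fst.snd)
    (fun g => sz (l g) * ((sz g + sz (l g) + 1 + 2) ^ c + 1) + 1)
    ((hs.mul (((((PolyLe.refl _).add hs).add (.const _ _)).pow c).add (.const _ _))).add
      (.const _ _))
    (fun g l₁ h => by
      rw [e]
      refine (sz_list_le (M := (sz g + sz (l g) + 1 + 2) ^ c) fun b hb => ?_).trans ?_
      · simp only [List.mem_reverse, List.mem_map] at hb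
        obtain ⟨a, ha, rfl⟩ := hb
        refine (hc (g, a)).trans (Nat.pow_le_pow_left ?_ c)
        rw [sz_prod]
        have := sz_le_of_mem (h.subset ha)
        omega
      · have h1 := h.length_le
        have h2 := length_lt_sz (l g)
        rw [List.length_reverse, List.length_map]
        gcongr
        omega)
  exact this.reverse.congr_enc fun g => by rw [e, List.reverse_reverse]

end PT

open Classical in
/-- The sublist of the elements with property `P`. -/
noncomputable def List.filterP {α : Type*} (P : α → Prop) (l : List α) : List α :=
  l.filter fun x => decide (P x)

@[simp] theorem List.mem_filterP {α : Type*} {P : α → Prop} {l : List α} {x : α} :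
    x ∈ l.filterP P ↔ x ∈ l ∧ P x := by
  simp [List.filterP]

theorem List.filterP_sublist {α : Type*} (P : α → Prop) (l : List α) : (l.filterP P).Sublist l :=
  List.filter_sublist

theorem List.filterP_congr {α : Type*} {P Q : α → Prop} {l : List α} (h : ∀ x ∈ l, P x ↔ Q x) :
    l.filterP P = l.filterP Q := by
  classical
  exact List.filter_congr fun x hx => by simp [h x hx]

namespace PT

variable {α β γ σ : Type} [Enc α] [Enc β] [Enc γ] [Enc σ]

theorem filterP {l : γ → List α} {P : γ → α → Prop} (hl : PT l)
    (hP : PTP fun x : γ × α => P x.1 x.2) : PT fun g => (l g).filterP (P g) := by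
  classical
  have hs := hl.choose_spec.choose_spec.2.2
  have e : ∀ g (l₁ acc : List α), l₁.foldl (fun acc x => if P g x then x :: acc else acc) acc =
      (l₁.filterP (P g)).reverse ++ acc := by
    intro g l₁
    induction l₁ with
    | nil => intro acc; rfl
    | cons x l₁ ih =>
      intro acc
      rw [List.foldl_cons, ih]
      by_cases h : P g x <;> simp [List.filterP, h]
  have := foldl (step := fun g acc x => if P g x then x :: acc else acc)
    (PT.const ([] : List α)) hl
    (PT.ite (P := fun x : (γ × List α) × α => P x.1.1 x.2)
      (PTP.comp hP (PT.id.fst.fst.pair PT.id.snd)) (PT.id.snd.cons PT.id.fst.snd) PT.id.fst.snd)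
    (fun g => sz (l g) * (sz (l g) + 1) + 1) ((hs.mul (hs.add (.const _ _))).add (.const _ _))
    (fun g l₁ h => by
      rw [e, List.append_nil]
      refine (sz_list_le (M := sz (l g)) fun a ha => sz_le_of_mem (h.subset ?_)).trans ?_
      · exact (List.mem_filterP.1 (List.mem_reverse.1 ha)).1
      have h1 := h.length_le
      have h2 := length_lt_sz (l g)
      have h3 := (List.filterP_sublist (P g) l₁).length_le
      rw [List.length_reverse]
      gcongr
      omega)
  exact this.reverse.congr_enc fun g => by rw [e, List.append_nil, List.reverse_reverse]

theorem length {l : γ → List α} (hl : PT l) : PT fun g => (l g).length :=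
  (hl.map (f := fun _ _ => ()) (PT.const ())).congr_enc fun g => by
    rw [enc_nat_eq, List.map_const']

theorem range {n : γ → ℕ} (hn : PT n) : PT fun g => List.range (n g) := by
  have hs := hn.choose_spec.choose_spec.2.2
  have e : ∀ j, (fun l : List ℕ => 0 :: l.map (· + 1))^[j] [] = List.range j := by
    intro j
    induction j with
    | zero => rfl
    | succ j ih => rw [Function.iterate_succ_apply', ih, List.range_succ_eq_map]
  have := iterate (f := fun _ l => 0 :: l.map (· + 1)) hn (PT.const ([] : List ℕ))
    ((PT.const 0).cons (PT.id.snd.map (f := fun _ m => m + 1) PT.id.snd.succ))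
    (fun g => sz (n g) * (sz (n g) + 1) + 1) ((hs.mul (hs.add (.const _ _))).add (.const _ _))
    (fun g j hj => by
      rw [e]
      have h1 := sz_nat (n g)
      refine (sz_list_le (M := sz (n g)) fun a ha => ?_).trans ?_
      · rw [sz_nat]
        have := List.mem_range.1 ha
        omega
      · rw [List.length_range]
        gcongr
        omega)
  exact this.congr_enc fun g => by rw [e]

theorem drop {l : γ → List α} {n : γ → ℕ} (hl : PT l) (hn : PT n) :
    PT fun g => (l g).drop (n g) := by
  have hs := hl.choose_spec.choose_spec.2.2
  have e : ∀ (l : List α) j, List.tail^[j] l = l.drop j := by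
    intro l j
    induction j with
    | zero => rfl
    | succ j ih => rw [Function.iterate_succ_apply', ih, List.tail_drop]
  have := iterate (f := fun _ l => l.tail) hn hl PT.id.snd.tail (fun g => sz (l g)) hs
    (fun g j _ => by rw [e]; exact sz_le_of_sublist (List.drop_sublist _ _))
  exact this.congr_enc fun g => by rw [e]

theorem getD {l : γ → List ℕ} {n : γ → ℕ} (hl : PT l) (hn : PT n) :
    PT fun g => (l g).getD (n g) 0 :=
  (hl.drop hn).headD_zero.congr_enc fun g => by
    rw [List.headD_eq_head?_getD, List.head?_drop, List.getD_eq_getElem?_getD]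

end PT

/-! ### Bounded quantifiers and comparisons -/

namespace PTP

variable {α β γ σ : Type} [Enc α] [Enc β] [Enc γ] [Enc σ]

theorem exists_mem {l : γ → List α} {P : γ → α → Prop} (hl : PT l)
    (hP : PTP fun x : γ × α => P x.1 x.2) : PTP fun g => ∃ x ∈ l g, P g x := by
  refine (PTP.enc_eq_nil (hl.filterP hP)).not.congr fun g => ?_
  have : enc ((l g).filterP (P g)) = Data.nil ↔ (l g).filterP (P g) = [] := by
    cases (l g).filterP (P g) <;> simp [enc, Data.ofList]
  rw [this, List.eq_nil_iff_forall_not_mem]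
  simp

theorem forall_mem {l : γ → List α} {P : γ → α → Prop} (hl : PT l)
    (hP : PTP fun x : γ × α => P x.1 x.2) : PTP fun g => ∀ x ∈ l g, P g x :=
  (exists_mem (P := fun g x => ¬ P g x) hl hP.not).not.congr fun g => by push Not; rfl

/-- Truncated subtraction is an iterated predecessor, and its result is `nil` exactly when the
inequality holds. -/
theorem nat_le {m n : γ → ℕ} (hm : PT m) (hn : PT n) : PTP fun g => m g ≤ n g := by
  have hs := hm.choose_spec.choose_spec.2.2
  have e : ∀ k j, (fun x => x - 1)^[j] k = k - j := by
    intro k j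
    induction j with
    | zero => rfl
    | succ j ih => rw [Function.iterate_succ_apply', ih]; omega
  have := PT.iterate (f := fun _ x => x - 1) hn hm PT.id.snd.pred (fun g => sz (m g)) hs
    (fun g j _ => by rw [e, sz_nat, sz_nat]; omega)
  refine (PTP.enc_eq_nil this).congr fun g => ?_
  rw [e, ← Nat.sub_eq_zero_iff_le]
  cases m g - n g <;> simp [enc, Data.ofNat]

theorem nat_eq {m n : γ → ℕ} (hm : PT m) (hn : PT n) : PTP fun g => m g = n g :=
  ((nat_le hm hn).and (nat_le hn hm)).congr fun _ => le_antisymm_iff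

theorem mem_nat {n : γ → ℕ} {l : γ → List ℕ} (hn : PT n) (hl : PT l) : PTP fun g => n g ∈ l g :=
  (exists_mem (P := fun g x => n g = x) hl (nat_eq (hn.comp PT.id.fst) PT.id.snd)).congr
    fun g => by simp

/-- Recursion on the constant tree yields a fixed nest of projections and tests for `nil`. In this
way finitely many graphs are built into a program. -/
theorem enc_eq_const {f : γ → α} (hf : PT f) (d : Data) : PTP fun g => enc (f g) = d := by
  have key : ∀ (d : Data) (h : γ → Data), PT h → PTP fun g => h g = d := by
    intro d
    induction d with
    | nil => exact fun h hh => PTP.enc_eq_nil hh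
    | cons a b iha ihb =>
      intro h hh
      refine ((PTP.enc_eq_nil hh).not.and ((iha _ hh.data_hd).and (ihb _ hh.data_tl))).congr
        fun g => ?_
      change h g = Data.cons a b ↔ ¬ h g = Data.nil ∧ _
      cases h g <;> simp [Data.hd, Data.tl]
  exact key d _ hf.data

end PTP

/-! ### Covering projections -/

namespace DartGraph

variable {V D V' D' V'' D'' : Type*}

theorem Covers.trans {G : DartGraph V D} {H : DartGraph V' D'} {K : DartGraph V'' D''}
    (h : G.Covers H) (h' : H.Covers K) : G.Covers K := by
  obtain ⟨fV, fD, h⟩ := h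
  obtain ⟨gV, gD, h'⟩ := h'
  exact ⟨gV ∘ fV, gD ∘ fD, h'.surjective_vertices.comp h.surjective_vertices,
    h'.surjective_darts.comp h.surjective_darts,
    fun u => (h'.bijOn_darts _).comp (h.bijOn_darts u),
    fun d => by simp [h.map_inv, h'.map_inv]⟩

theorem Covers.of_equiv {G : DartGraph V D} {H : DartGraph V' D'} (eV : V ≃ V') (eD : D ≃ D')
    (hb : ∀ d, H.base (eD d) = eV (G.base d)) (hi : ∀ d, H.inv (eD d) = eD (G.inv d)) :
    G.Covers H := by
  refine ⟨eV, eD, eV.surjective, eD.surjective, fun u => ⟨fun d hd => ?_, eD.injective.injOn,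
    fun d hd => ⟨eD.symm d, ?_, by simp⟩⟩, fun d => (hi d).symm⟩
  · simp only [Set.mem_ofPred_eq] at hd ⊢
    rw [hb, hd]
  · simp only [Set.mem_ofPred_eq] at hd ⊢
    apply eV.injective
    rw [← hb, ← hd, Equiv.apply_symm_apply]

theorem Covers.size_le [Finite V] [Finite D] {G : DartGraph V D} {H : DartGraph V' D'}
    (h : G.Covers H) : H.size ≤ G.size := by
  obtain ⟨fV, fD, h⟩ := h
  refine add_le_add (Nat.card_le_card_of_surjective fV h.surjective_vertices) ?_
  have e : H.links ⊆ (fun s => fD '' s) '' G.links := by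
    rintro _ ⟨d', rfl⟩
    obtain ⟨d, rfl⟩ := h.surjective_darts d'
    exact ⟨_, ⟨d, rfl⟩, by simp [Set.image_pair, h.map_inv]⟩
  exact (Set.ncard_le_ncard e (Set.toFinite _)).trans (Set.ncard_image_le (Set.toFinite _))

/-- The graph transported along bijections of vertices and darts. -/
def pullback (K : DartGraph V D) (eV : V' ≃ V) (eD : D' ≃ D) : DartGraph V' D' where
  base d := eV.symm (K.base (eD d))
  inv d := eD.symm (K.inv (eD d))
  inv_inv d := by simp [K.inv_inv]

theorem pullback_covers (K : DartGraph V D) (eV : V' ≃ V) (eD : D' ≃ D) :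
    (K.pullback eV eD).Covers K :=
  .of_equiv eV eD (by simp [pullback]) (by simp [pullback])

theorem covers_pullback (K : DartGraph V D) (eV : V' ≃ V) (eD : D' ≃ D) :
    K.Covers (K.pullback eV eD) :=
  .of_equiv eV.symm eD.symm (by simp [pullback]) (by simp [pullback])

/-- From left to right, `f` is a section of the induced map on components, which is onto because the
vertex map is. From right to left, a component `f c'` is sent to `c'`, every other one to any
component that it covers, and the projections are glued. -/
theorem surjectivelyCovers_iff {G : DartGraph V D} {H : DartGraph V' D'} :
    G.SurjectivelyCovers H ↔
      (∀ c : G.Component, ∃ c' : H.Component, (G.component c).Covers (H.component c')) ∧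
      ∃ f : H.Component → G.Component, Function.Injective f ∧
        ∀ c', (G.component (f c')).Covers (H.component c') := by
  classical
  constructor
  · rintro ⟨fV, fD, h⟩
    choose a gV gD h1 h2 h3 using h.restriction
    have ha : Function.Surjective a := by
      intro c'
      induction c' using SimpleGraph.ConnectedComponent.ind with
      | _ w =>
        obtain ⟨v, rfl⟩ := h.surjective_vertices w
        refine ⟨G.adjacency.connectedComponentMk v, ?_⟩
        have h4 := (gV (G.adjacency.connectedComponentMk v) ⟨v, rfl⟩).2
        rw [h1] at h4
        exact h4.symm
    refine ⟨fun c => ⟨a c, gV c, gD c, h3 c⟩, Function.surjInv ha,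
      Function.injective_surjInv ha, fun c' => ?_⟩
    have h5 : (G.component (Function.surjInv ha c')).Covers
        (H.component (a (Function.surjInv ha c'))) := ⟨_, _, h3 _⟩
    rwa [Function.surjInv_eq ha c'] at h5
  · rintro ⟨h, f, hf, hfc⟩
    have : ∃ a : G.Component → H.Component, (∀ c', a (f c') = c') ∧
        ∀ c, (G.component c).Covers (H.component (a c)) := by
      have h' : ∀ c, ∃ x, (∀ c', f c' = c → x = c') ∧
          (G.component c).Covers (H.component x) := by
        intro c
        by_cases hc : ∃ c', f c' = c
        · obtain ⟨c', rfl⟩ := hc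
          exact ⟨c', fun c'' e => (hf e).symm, hfc c'⟩
        · obtain ⟨x, hx⟩ := h c
          exact ⟨x, fun c' e => absurd ⟨c', e⟩ hc, hx⟩
      choose a ha hc using h'
      exact ⟨a, fun c' => ha _ _ rfl, hc⟩
    obtain ⟨a, haf, ha⟩ := this
    choose gV gD hg using ha
    -- The glued map uses the component of the vertex itself as index; this identifies it with `gV
    -- c` for any `c` that contains the vertex.
    have hV : ∀ (c : G.Component) (v : {v // v ∈ c.supp}),
        (gV c v : V') = gV (G.adjacency.connectedComponentMk v.1) ⟨v.1, rfl⟩ := by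
      rintro c ⟨v, hv⟩
      obtain rfl : _ = c := hv
      rfl
    have hD : ∀ (c : G.Component) (d : {d // G.base d ∈ c.supp}),
        (gD c d : D') = gD (G.adjacency.connectedComponentMk (G.base d.1)) ⟨d.1, rfl⟩ := by
      rintro c ⟨d, hd⟩
      obtain rfl : _ = c := hd
      rfl
    refine ⟨fun v => gV (G.adjacency.connectedComponentMk v) ⟨v, rfl⟩,
      fun d => gD (G.adjacency.connectedComponentMk (G.base d)) ⟨d, rfl⟩,
      fun c => ⟨a c, gV c, gD c, hV c, hD c, hg c⟩, fun w => ?_, fun d => ?_⟩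
    · obtain ⟨v, hv⟩ := (hg (f (H.adjacency.connectedComponentMk w))).surjective_vertices
        ⟨w, by rw [haf]; rfl⟩
      exact ⟨v, by rw [← hV, hv]⟩
    · obtain ⟨d', hd'⟩ := (hg (f (H.adjacency.connectedComponentMk (H.base d)))).surjective_darts
        ⟨d, by rw [haf]; rfl⟩
      exact ⟨d', by rw [← hD, hd']⟩

theorem adjacency_adj {G : DartGraph V D} {u w : V} :
    G.adjacency.Adj u w ↔ u ≠ w ∧ ∃ d, G.base d = u ∧ G.base (G.inv d) = w := by
  rw [adjacency, SimpleGraph.fromRel_adj]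
  refine and_congr_right fun _ => or_iff_left_of_imp ?_
  rintro ⟨d, h1, h2⟩
  exact ⟨G.inv d, h2, by rw [G.inv_inv, h1]⟩

end DartGraph

/-! ### Extracting the components of an input graph -/

theorem List.filterP_mem_filterP {α : Type*} (P : α → Prop) (l : List α) :
    l.filterP (fun x => x ∈ l.filterP P) = l.filterP P :=
  List.filterP_congr fun x hx => by simp [hx]

/-- The position of `x` in `l` (if it occurs). -/
noncomputable def List.pos (l : List ℕ) (x : ℕ) : ℕ :=
  ((List.range l.length).filterP fun i => l.getD i 0 = x).headD 0

theorem List.pos_spec {l : List ℕ} {x : ℕ} (hx : x ∈ l) :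
    l.pos x < l.length ∧ l.getD (l.pos x) 0 = x := by
  have key : ∀ l' : List ℕ, l' ≠ [] → l'.headD 0 ∈ l' := by
    intro l' h
    cases l' with
    | nil => exact absurd rfl h
    | cons a l' => simp
  have h := key ((List.range l.length).filterP fun i => l.getD i 0 = x) (by
    obtain ⟨i, hi, rfl⟩ := List.getElem_of_mem hx
    apply List.ne_nil_of_mem (a := i)
    rw [List.mem_filterP]
    exact ⟨List.mem_range.2 hi, by simp [hi]⟩)
  exact ⟨List.mem_range.1 (List.mem_filterP.1 h).1, (List.mem_filterP.1 h).2⟩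

/-- Without repetitions, lookup and position are mutually inverse. This renumbers the vertices or
darts of a component by their places in a computed list. -/
theorem List.Nodup.exists_equiv_fin {l : List ℕ} (hl : l.Nodup) {n : ℕ} {P : Fin n → Prop}
    (hlt : ∀ x ∈ l, x < n) (h : ∀ w : Fin n, (w : ℕ) ∈ l ↔ P w) :
    ∃ e : Fin l.length ≃ {w : Fin n // P w}, ∀ i, ((e i).1 : ℕ) = l.getD i 0 ∧
      l.pos (e i).1 = i := by
  have hg : ∀ i : Fin l.length, l.getD i 0 ∈ l := fun i => by simp
  have hinj : ∀ i j, i < l.length → j < l.length → l.getD i 0 = l.getD j 0 → i = j := by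
    intro i j hi hj hij
    simp only [List.getD_eq_getElem?_getD, List.getElem?_eq_getElem hi,
      List.getElem?_eq_getElem hj, Option.getD_some] at hij
    exact (hl.getElem_inj_iff).1 hij
  refine ⟨Equiv.ofBijective (fun i => ⟨⟨l.getD i 0, hlt _ (hg i)⟩, (h _).1 (hg i)⟩) ⟨?_, ?_⟩,
    fun i => ⟨rfl, ?_⟩⟩
  · intro i j hij
    exact Fin.ext (hinj i j i.2 j.2 (by simpa only [Subtype.mk.injEq, Fin.mk.injEq] using hij))
  · rintro ⟨w, hw⟩
    obtain ⟨h1, h2⟩ := List.pos_spec ((h w).2 hw)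
    exact ⟨⟨_, h1⟩, Subtype.ext (Fin.ext h2)⟩
  · obtain ⟨h1, h2⟩ := List.pos_spec (hg i)
    exact hinj _ _ h1 i.2 h2

namespace InputGraph

variable (G : InputGraph)

/-- The list of the base vertices of the darts. -/
def bases : List ℕ := List.ofFn fun d => (G.graph.base d : ℕ)

/-- The list of the inverses of the darts. -/
def invs : List ℕ := List.ofFn fun d => (G.graph.inv d : ℕ)

theorem bases_getD (d : Fin G.numDarts) : G.bases.getD d 0 = G.graph.base d := by
  simp [bases]

theorem invs_getD (d : Fin G.numDarts) : G.invs.getD d 0 = G.graph.inv d := by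
  simp [invs]

/-- The vertices that are in `S` or adjacent to a vertex in `S`. -/
noncomputable def expand (S : List ℕ) : List ℕ :=
  (List.range G.numVertices).filterP fun u => u ∈ S ∨ ∃ d ∈ List.range G.numDarts,
    G.bases.getD d 0 = u ∧ G.bases.getD (G.invs.getD d 0) 0 ∈ S

theorem mem_expand {S : List ℕ} {u : Fin G.numVertices} : (u : ℕ) ∈ G.expand S ↔
    (u : ℕ) ∈ S ∨ ∃ d, G.graph.base d = u ∧ (G.graph.base (G.graph.inv d) : ℕ) ∈ S := by
  simp only [expand, List.mem_filterP, List.mem_range, u.2, true_and]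
  refine or_congr_right ⟨?_, ?_⟩
  · rintro ⟨d, hd, h1, h2⟩
    rw [G.bases_getD ⟨d, hd⟩] at h1
    rw [G.invs_getD ⟨d, hd⟩, bases_getD] at h2
    exact ⟨⟨d, hd⟩, Fin.ext h1, h2⟩
  · rintro ⟨d, rfl, h2⟩
    exact ⟨d, d.2, G.bases_getD d, by rwa [G.invs_getD, bases_getD]⟩

/-- The vertices in the component of `v`. -/
noncomputable def reach (v : ℕ) : List ℕ :=
  G.expand^[G.numVertices] ((List.range G.numVertices).filterP (· = v))

/-- Each iterate is a sublist of the range, determined by its set of members. Hence iterates have no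
repetitions, their size stays bounded, and `reach` depends only on the component of its argument. -/
theorem iterate_expand_eq_filterP (v k : ℕ) :
    G.expand^[k] ((List.range G.numVertices).filterP (· = v)) =
      (List.range G.numVertices).filterP
        (· ∈ G.expand^[k] ((List.range G.numVertices).filterP (· = v))) := by
  cases k with
  | zero => exact (List.filterP_mem_filterP _ _).symm
  | succ k => rw [Function.iterate_succ_apply']; exact (List.filterP_mem_filterP _ _).symm

theorem mem_reach {u v : Fin G.numVertices} :
    (u : ℕ) ∈ G.reach v ↔ G.graph.adjacency.Reachable u v := by
  constructor
  · have key : ∀ (k : ℕ) (u : Fin G.numVertices),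
        (u : ℕ) ∈ G.expand^[k] ((List.range G.numVertices).filterP (· = (v : ℕ))) →
          G.graph.adjacency.Reachable u v := by
      intro k
      induction k with
      | zero =>
        intro u hu
        simp only [Function.iterate_zero, id, List.mem_filterP] at hu
        rw [Fin.ext hu.2]
      | succ k ih =>
        intro u hu
        rw [Function.iterate_succ_apply', mem_expand] at hu
        rcases hu with hu | ⟨d, rfl, hd⟩
        · exact ih u hu
        · refine SimpleGraph.Reachable.trans ?_ (ih _ hd)
          by_cases e : G.graph.base d = G.graph.base (G.graph.inv d)
          · rw [← e]
          · exact (DartGraph.adjacency_adj.2 ⟨e, d, rfl, rfl⟩).reachable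
    exact key _ u
  · intro h
    have key : ∀ (u v : Fin G.numVertices) (p : G.graph.adjacency.Walk u v) (k : ℕ),
        p.length ≤ k →
        (u : ℕ) ∈ G.expand^[k] ((List.range G.numVertices).filterP (· = (v : ℕ))) := by
      intro u v p
      induction p with
      | nil =>
        intro k _
        induction k with
        | zero => simp
        | succ k ih => rw [Function.iterate_succ_apply', mem_expand]; exact Or.inl (ih (by simp))
      | cons hadj p ih =>
        intro k hk
        rw [SimpleGraph.Walk.length_cons] at hk
        obtain ⟨k, rfl⟩ : ∃ j, k = j + 1 := ⟨k - 1, by omega⟩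
        rw [Function.iterate_succ_apply', mem_expand]
        obtain ⟨-, d, h1, h2⟩ := DartGraph.adjacency_adj.1 hadj
        exact Or.inr ⟨d, h1, h2 ▸ ih k (by omega)⟩
    -- A path is shorter than the number of vertices, so `numVertices` rounds of expansion suffice.
    obtain ⟨p, hp⟩ := h.exists_isPath
    exact key u v p _ (by simpa using hp.length_lt.le)

theorem reach_nodup (v : ℕ) : (G.reach v).Nodup := by
  rw [reach, iterate_expand_eq_filterP]
  exact List.nodup_range.sublist (List.filterP_sublist _ _)

theorem lt_of_mem_reach {v u : ℕ} (h : u ∈ G.reach v) : u < G.numVertices := by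
  rw [reach, iterate_expand_eq_filterP, List.mem_filterP, List.mem_range] at h
  exact h.1

theorem reach_congr {v w : Fin G.numVertices} (h : G.graph.adjacency.Reachable v w) :
    G.reach v = G.reach w := by
  rw [reach, iterate_expand_eq_filterP, reach, iterate_expand_eq_filterP G w]
  refine List.filterP_congr fun x hx => ?_
  have hv := G.mem_reach (u := ⟨x, List.mem_range.1 hx⟩) (v := v)
  have hw := G.mem_reach (u := ⟨x, List.mem_range.1 hx⟩) (v := w)
  refine hv.trans (Iff.trans ?_ hw.symm)
  exact ⟨fun h' => h'.trans h, fun h' => h'.trans h.symm⟩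

/-- The darts in the component of `v`. -/
noncomputable def reachDarts (v : ℕ) : List ℕ :=
  (List.range G.numDarts).filterP fun d => G.bases.getD d 0 ∈ G.reach v

theorem mem_reachDarts {d : Fin G.numDarts} {v : Fin G.numVertices} :
    (d : ℕ) ∈ G.reachDarts v ↔ G.graph.adjacency.Reachable (G.graph.base d) v := by
  rw [reachDarts, List.mem_filterP, bases_getD, mem_reach, List.mem_range]
  exact and_iff_right d.2

/-- The component of `v`, renumbered, as a number and a list of pairs. -/
noncomputable def rawComponent (v : ℕ) : ℕ × List (ℕ × ℕ) :=
  ((G.reach v).length, (G.reachDarts v).map fun d =>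
    ((G.reach v).pos (G.bases.getD d 0), (G.reachDarts v).pos (G.invs.getD d 0)))

/-- The number of vertices and the list of the pairs `(base d, inv d)`. -/
def raw : ℕ × List (ℕ × ℕ) :=
  (G.numVertices, List.ofFn fun d => ((G.graph.base d : ℕ), (G.graph.inv d : ℕ)))

theorem enc_raw : enc G.raw = enc G := by
  simp only [raw, enc, InputGraph.encode, List.map_ofFn]
  rfl

/-- The graph is the component pulled back along the renumberings. Covering in both directions
stands in for isomorphism: it transfers covers, sizes and the complexity of the covering problem. -/
theorem exists_component (v : Fin G.numVertices) : ∃ C : InputGraph,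
    C.raw = G.rawComponent v ∧
    C.graph.Covers (G.graph.component (G.graph.adjacency.connectedComponentMk v)) ∧
    (G.graph.component (G.graph.adjacency.connectedComponentMk v)).Covers C.graph := by
  obtain ⟨eV, hV⟩ := (G.reach_nodup v).exists_equiv_fin
    (P := fun w => w ∈ (G.graph.adjacency.connectedComponentMk v).supp)
    (fun x hx => G.lt_of_mem_reach hx) (fun w => by
      rw [mem_reach, SimpleGraph.ConnectedComponent.mem_supp_iff,
        SimpleGraph.ConnectedComponent.eq])
  obtain ⟨eD, hD⟩ := List.Nodup.exists_equiv_fin (l := G.reachDarts v)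
    (P := fun d => G.graph.base d ∈ (G.graph.adjacency.connectedComponentMk v).supp)
    (List.nodup_range.sublist (List.filterP_sublist _ _))
    (fun x hx => List.mem_range.1 (List.mem_filterP.1 hx).1) (fun d => by
      rw [mem_reachDarts, SimpleGraph.ConnectedComponent.mem_supp_iff,
        SimpleGraph.ConnectedComponent.eq])
  refine ⟨⟨_, _, (G.graph.component _).pullback eV eD⟩, ?_, DartGraph.pullback_covers _ _ _,
    DartGraph.covers_pullback _ _ _⟩
  refine Prod.ext rfl (List.ext_getElem (by simp [raw, rawComponent]) fun i h1 h2 => ?_)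
  have hi : i < (G.reachDarts v).length := by simpa [rawComponent] using h2
  have e1 : (G.reachDarts v)[i] = ((eD ⟨i, hi⟩).1 : ℕ) := by
    rw [(hD ⟨i, hi⟩).1]
    simp [hi]
  simp only [raw, rawComponent, List.getElem_ofFn, List.getElem_map, e1, bases_getD, invs_getD]
  refine Prod.ext ?_ ?_
  · have := (hV (eV.symm ((G.graph.component _).base (eD ⟨i, hi⟩)))).2
    rw [Equiv.apply_symm_apply] at this
    exact this.symm
  · have := (hD (eD.symm ((G.graph.component _).inv (eD ⟨i, hi⟩)))).2
    rw [Equiv.apply_symm_apply] at this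
    exact this.symm

/-- The graph can be chosen for the component rather than the vertex, since `rawComponent v` depends
on `v` only through `reach v`. -/
theorem exists_componentGraph (c : G.graph.Component) : ∃ C : InputGraph,
    (∀ v, G.graph.adjacency.connectedComponentMk v = c → C.raw = G.rawComponent v) ∧
    C.graph.Covers (G.graph.component c) ∧ (G.graph.component c).Covers C.graph := by
  induction c using SimpleGraph.ConnectedComponent.ind with
  | _ w =>
    obtain ⟨C, h1, h2⟩ := G.exists_component w
    refine ⟨C, fun v hv => h1.trans ?_, h2⟩
    have e := G.reach_congr (SimpleGraph.ConnectedComponent.exact hv)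
    simp only [rawComponent, reachDarts, e]

/-- A component as an input graph. -/
noncomputable def componentGraph (c : G.graph.Component) : InputGraph :=
  (G.exists_componentGraph c).choose

theorem raw_componentGraph (v : Fin G.numVertices) :
    (G.componentGraph (G.graph.adjacency.connectedComponentMk v)).raw = G.rawComponent v :=
  (G.exists_componentGraph _).choose_spec.1 v rfl

theorem componentGraph_covers (c : G.graph.Component) :
    (G.componentGraph c).graph.Covers (G.graph.component c) :=
  (G.exists_componentGraph c).choose_spec.2.1

theorem covers_componentGraph (c : G.graph.Component) :
    (G.graph.component c).Covers (G.componentGraph c).graph :=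
  (G.exists_componentGraph c).choose_spec.2.2

/-- The components, each of them listed once. -/
noncomputable def componentList : List G.graph.Component :=
  ((List.finRange G.numVertices).filterP fun v : Fin G.numVertices =>
    (G.reach v).headD 0 = (v : ℕ)).map
    G.graph.adjacency.connectedComponentMk

/-- The head of `reach v` is the same for all `v` in a component, hence a canonical representative
of it. -/
theorem componentList_nodup : G.componentList.Nodup := by
  refine List.Nodup.map_on ?_ ((List.nodup_finRange _).sublist (List.filterP_sublist _ _))
  intro v hv w hw h
  have e := G.reach_congr (SimpleGraph.ConnectedComponent.exact h)
  rw [List.mem_filterP] at hv hw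
  rw [← Fin.val_inj, ← hv.2, ← hw.2, e]

theorem mem_componentList (c : G.graph.Component) : c ∈ G.componentList := by
  induction c using SimpleGraph.ConnectedComponent.ind with
  | _ v =>
    have h : (G.reach v).headD 0 ∈ G.reach v := by
      have h0 := G.mem_reach.2 (SimpleGraph.Reachable.refl v)
      cases h1 : G.reach v with
      | nil => simp [h1] at h0
      | cons a l => simp
    have hlt := G.lt_of_mem_reach h
    have hr : G.graph.adjacency.Reachable ⟨(G.reach v).headD 0, hlt⟩ v := G.mem_reach.1 h
    refine List.mem_map.2 ⟨⟨_, hlt⟩, List.mem_filterP.2 ⟨List.mem_finRange _, ?_⟩,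
      SimpleGraph.ConnectedComponent.eq.2 hr⟩
    rw [G.reach_congr hr]

/-- The components as input graphs. -/
noncomputable def components : List InputGraph := G.componentList.map G.componentGraph

/-- The right side involves only numbers and lists, so it can be computed; the components as
abstract objects never enter a program. -/
theorem components_map_raw : G.components.map raw =
    ((List.range G.numVertices).filterP fun v => (G.reach v).headD 0 = v).map G.rawComponent := by
  classical
  rw [components, componentList, List.map_map, List.map_map, ← List.map_coe_finRange_eq_range,
    List.filterP, List.filterP, List.filter_map, List.map_map]
  refine List.map_congr_left fun v _ => ?_
  exact G.raw_componentGraph v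

theorem exists_mem_components {P : InputGraph → Prop} :
    (∃ C ∈ G.components, P C) ↔ ∃ c, P (G.componentGraph c) := by
  simp [components, mem_componentList]

theorem forall_mem_components {P : InputGraph → Prop} :
    (∀ C ∈ G.components, P C) ↔ ∀ c, P (G.componentGraph c) := by
  simp [components, mem_componentList]

theorem length_filterP_components (P : InputGraph → Prop) :
    (G.components.filterP P).length = Nat.card {c : G.graph.Component // P (G.componentGraph c)} := by
  classical
  rw [components, List.filterP, List.filter_map, List.length_map,
    ← List.toFinset_card_of_nodup (G.componentList_nodup.filter _), Nat.card_eq_fintype_card,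
    Fintype.card_subtype]
  congr 1
  ext c
  simp [mem_componentList]

end InputGraph

/-! ### The components are computed in polynomial time -/

namespace PT

variable {γ : Type} [Enc γ]

theorem raw {G : γ → InputGraph} (hG : PT G) : PT fun x => (G x).raw :=
  hG.congr_enc fun _ => InputGraph.enc_raw _

theorem numVertices {G : γ → InputGraph} (hG : PT G) : PT fun x => (G x).numVertices := hG.raw.fst

theorem numDarts {G : γ → InputGraph} (hG : PT G) : PT fun x => (G x).numDarts :=
  hG.raw.snd.length.congr_enc fun x => by simp [InputGraph.raw]

theorem bases {G : γ → InputGraph} (hG : PT G) : PT fun x => (G x).bases :=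
  (hG.raw.snd.map (f := fun _ p => p.1) PT.id.snd.fst).congr_enc fun x => by
    simp only [InputGraph.raw, List.map_ofFn, InputGraph.bases]; rfl

theorem invs {G : γ → InputGraph} (hG : PT G) : PT fun x => (G x).invs :=
  (hG.raw.snd.map (f := fun _ p => p.2) PT.id.snd.snd).congr_enc fun x => by
    simp only [InputGraph.raw, List.map_ofFn, InputGraph.invs]; rfl

theorem pos {l : γ → List ℕ} {n : γ → ℕ} (hl : PT l) (hn : PT n) : PT fun x => (l x).pos (n x) :=
  (hl.length.range.filterP (P := fun x i => (l x).getD i 0 = n x)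
    (.nat_eq ((hl.comp PT.id.fst).getD PT.id.snd) (hn.comp PT.id.fst))).headD_zero

theorem expand {G : γ → InputGraph} {S : γ → List ℕ} (hG : PT G) (hS : PT S) :
    PT fun x => (G x).expand (S x) := by
  refine hG.numVertices.range.filterP ?_
  refine .or (.mem_nat PT.id.snd (hS.comp PT.id.fst)) ?_
  refine .exists_mem (P := fun (y : γ × ℕ) d => (G y.1).bases.getD d 0 = y.2 ∧
    (G y.1).bases.getD ((G y.1).invs.getD d 0) 0 ∈ S y.1) (hG.numDarts.range.comp PT.id.fst) ?_
  have hG' : PT fun z : (γ × ℕ) × ℕ => G z.1.1 := hG.comp PT.id.fst.fst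
  exact .and (.nat_eq (hG'.bases.getD PT.id.snd) PT.id.fst.snd)
    (.mem_nat (hG'.bases.getD (hG'.invs.getD PT.id.snd)) (hS.comp PT.id.fst.fst))

theorem reach {G : γ → InputGraph} {v : γ → ℕ} (hG : PT G) (hv : PT v) :
    PT fun x => (G x).reach (v x) := by
  have hr := hG.numVertices.range
  refine iterate (f := fun x S => (G x).expand S) hG.numVertices
    (hr.filterP (P := fun x u => u = v x) (.nat_eq PT.id.snd (hv.comp PT.id.fst)))
    (expand (hG.comp PT.id.fst) PT.id.snd) (fun x => sz (List.range (G x).numVertices))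
    hr.choose_spec.choose_spec.2.2 fun x j _ => ?_
  rw [InputGraph.iterate_expand_eq_filterP]
  exact sz_le_of_sublist (List.filterP_sublist _ _)

theorem reachDarts {G : γ → InputGraph} {v : γ → ℕ} (hG : PT G) (hv : PT v) :
    PT fun x => (G x).reachDarts (v x) :=
  hG.numDarts.range.filterP (.mem_nat ((hG.comp PT.id.fst).bases.getD PT.id.snd)
    ((hG.reach hv).comp PT.id.fst))

theorem rawComponent {G : γ → InputGraph} {v : γ → ℕ} (hG : PT G) (hv : PT v) :
    PT fun x => (G x).rawComponent (v x) :=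
  (hG.reach hv).length.pair ((hG.reachDarts hv).map
    (f := fun x d => (((G x).reach (v x)).pos ((G x).bases.getD d 0),
      ((G x).reachDarts (v x)).pos ((G x).invs.getD d 0)))
    ((((hG.reach hv).comp PT.id.fst).pos ((hG.comp PT.id.fst).bases.getD PT.id.snd)).pair
      (((hG.reachDarts hv).comp PT.id.fst).pos ((hG.comp PT.id.fst).invs.getD PT.id.snd))))

theorem components {G : γ → InputGraph} (hG : PT G) : PT fun x => (G x).components := by
  have hG' : PT fun y : γ × ℕ => G y.1 := hG.comp PT.id.fst
  have := (hG.numVertices.range.filterP (P := fun x v => ((G x).reach v).headD 0 = v)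
    (.nat_eq (hG'.reach PT.id.snd).headD_zero PT.id.snd)).map
      (f := fun x v => (G x).rawComponent v) (hG'.rawComponent PT.id.snd)
  refine this.congr_enc fun x => ?_
  rw [← InputGraph.components_map_raw]
  simp only [enc, List.map_map]
  congr 1
  exact List.map_congr_left fun C _ => (InputGraph.enc_raw C).symm

end PT

/-! ### Surjective covering projections and Hall's condition -/

namespace DartGraph

variable {V D V' D' : Type*}

/-- Hall's marriage theorem, applied to the sets `t c'` of components of `G` that cover `c'`. -/
theorem surjectivelyCovers_iff_card [Finite V] [Finite V'] {G : DartGraph V D}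
    {H : DartGraph V' D'} : G.SurjectivelyCovers H ↔
      (∀ c : G.Component, ∃ c' : H.Component, (G.component c).Covers (H.component c')) ∧
      ∀ S : Finset H.Component,
        S.card ≤ Nat.card {c : G.Component // ∃ c' ∈ S, (G.component c).Covers (H.component c')} := by
  classical
  have := Fintype.ofFinite G.Component
  rw [surjectivelyCovers_iff]
  refine and_congr_right fun _ => ?_
  let t : H.Component → Finset G.Component := fun c' =>
    Finset.univ.filter fun c => (G.component c).Covers (H.component c')
  have h := Finset.all_card_le_biUnion_card_iff_exists_injective t
  simp only [t, Finset.mem_filter, Finset.mem_univ, true_and] at h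
  rw [← h]
  refine forall_congr' fun S => ?_
  rw [Nat.card_eq_fintype_card, Fintype.card_subtype]
  congr! 2
  ext c
  simp

/-- This makes the parameter testable component by component. The alternative `k = 0` is for the
graph without components, whose supremum is `0` by convention. -/
theorem maxComponentSize_eq_iff [Finite V] (H : DartGraph V D) (k : ℕ) :
    H.maxComponentSize = k ↔ (∀ c, (H.component c).size ≤ k) ∧
      (k = 0 ∨ ∃ c, (H.component c).size = k) := by
  have hb : BddAbove (Set.range fun c : H.Component => (H.component c).size) :=
    (Set.finite_range _).bddAbove
  constructor
  · rintro rfl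
    refine ⟨fun c => le_ciSup hb c, ?_⟩
    rcases isEmpty_or_nonempty H.Component with h | h
    · left
      simp [maxComponentSize]
    · exact Or.inr (exists_eq_ciSup_of_finite)
  · rintro ⟨h1, rfl | ⟨c, hc⟩⟩
    · rcases isEmpty_or_nonempty H.Component with h | h
      · simp [maxComponentSize]
      · exact Nat.le_zero.1 (ciSup_le h1)
    · have : Nonempty H.Component := ⟨c⟩
      exact le_antisymm (ciSup_le h1) (hc ▸ le_ciSup hb c)

theorem polyTime_coverProblem_congr {G : DartGraph V D} {H : DartGraph V' D'} (h : G.Covers H)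
    (h' : H.Covers G) (hG : G.coverProblem.PolyTime) : H.coverProblem.PolyTime := by
  obtain ⟨p, k, hp⟩ := hG
  refine ⟨p, k, fun x _ => ?_⟩
  obtain ⟨t, n, h1, h2, h3⟩ := hp x trivial
  exact ⟨t, n, h1, h2, h3.trans ⟨fun h4 => Covers.trans h4 h, fun h4 => Covers.trans h4 h'⟩⟩

theorem size_eq_of_covers [Finite V] [Finite D] [Finite V'] [Finite D'] {G : DartGraph V D}
    {H : DartGraph V' D'} (h : G.Covers H) (h' : H.Covers G) : G.size = H.size :=
  le_antisymm h'.size_le h.size_le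

theorem links_ncard_le {n m : ℕ} (G : DartGraph (Fin n) (Fin m)) : G.links.ncard ≤ m := by
  have h : G.links = (fun d => {d, G.inv d}) '' Set.univ := Set.image_univ.symm
  rw [h]
  exact (Set.ncard_image_le Set.finite_univ).trans (by simp)

/-- The map from darts to links has fibres of at most two elements. The size counts links while the
encoding lists darts, so this bound is needed to compare them. -/
theorem le_two_mul_links_ncard {n m : ℕ} (G : DartGraph (Fin n) (Fin m)) :
    m ≤ 2 * G.links.ncard := by
  classical
  have h := Finset.card_le_mul_card_image (f := fun d => ({d, G.inv d} : Set (Fin m)))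
    Finset.univ 2 (fun s hs => by
      obtain ⟨d, -, rfl⟩ := Finset.mem_image.1 hs
      refine (Finset.card_le_card (t := {d, G.inv d}) fun x hx => ?_).trans Finset.card_le_two
      have h1 := (Finset.mem_filter.1 hx).2
      have h2 : x ∈ ({d, G.inv d} : Set (Fin m)) := h1 ▸ Set.mem_insert _ _
      simpa using h2)
  have h' : G.links =
      ((Finset.univ.image fun d => ({d, G.inv d} : Set (Fin m)) : Finset _) : Set _) := by
    simp [links]
  rw [h', Set.ncard_coe_finset]
  simpa using h

instance [Finite V] [Finite D] : Finite (DartGraph V D) :=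
  Finite.of_injective (fun G => (G.base, G.inv)) fun G H h => by
    cases G; cases H; simp_all

end DartGraph

/-! ### Size and encoding of input graphs -/

namespace InputGraph

theorem graph_size (G : InputGraph) : G.graph.size = G.numVertices + G.graph.links.ncard := by
  simp [DartGraph.size]

theorem size_le_sz (G : InputGraph) : G.graph.size ≤ sz G := by
  have h1 := G.graph.links_ncard_le
  have h2 : sz G = sz G.raw := by rw [sz, sz, enc_raw]
  have h3 := length_lt_sz G.raw.2
  rw [graph_size, h2, raw, sz_prod, sz_nat]
  simp only [raw, List.length_ofFn] at h3
  omega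

/-- There are at most `2 * l` darts for `l` links, each encoded by two unary numbers of linear
length; the total is quadratic. -/
theorem sz_le (G : InputGraph) : sz G ≤ 40 * (G.graph.size + 1) ^ 2 := by
  have h1 := G.graph.le_two_mul_links_ncard
  have h2 : sz G = sz G.raw := by rw [sz, sz, enc_raw]
  have h3 : sz G.raw.2 ≤ G.raw.2.length * (2 * G.numVertices + 2 * G.numDarts + 3 + 1) + 1 := by
    refine sz_list_le fun a ha => ?_
    simp only [raw, List.mem_ofFn] at ha
    obtain ⟨d, rfl⟩ := ha
    rw [sz_prod, sz_nat, sz_nat]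
    have := (G.graph.base d).2
    have := (G.graph.inv d).2
    omega
  have h4 : sz G.raw = 2 * G.numVertices + 1 + sz G.raw.2 + 1 := by
    rw [← sz_nat]; rfl
  have h5 : G.raw.2.length = G.numDarts := by simp [raw]
  rw [h5] at h3
  rw [graph_size, h2, h4]
  set l := G.graph.links.ncard
  have h6 : G.numDarts * (2 * G.numVertices + 2 * G.numDarts + 3 + 1) ≤
      2 * l * (2 * G.numVertices + 2 * (2 * l) + 3 + 1) := by gcongr
  nlinarith

theorem enc_nat_injective : Function.Injective (enc : ℕ → Data) := by
  intro m
  induction m with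
  | zero => intro n h; cases n <;> simp_all [enc, Data.ofNat]
  | succ m ih =>
    intro n h
    cases n with
    | zero => simp [enc, Data.ofNat] at h
    | succ n =>
      have h' : Data.cons Data.nil (enc m) = Data.cons Data.nil (enc n) := h
      rw [ih (Data.cons.inj h').2]

theorem enc_prod_injective {α β : Type} [Enc α] [Enc β]
    (hα : Function.Injective (enc : α → Data)) (hβ : Function.Injective (enc : β → Data)) :
    Function.Injective (enc : α × β → Data) := by
  rintro ⟨a, b⟩ ⟨a', b'⟩ h
  have h' : Data.cons (enc a) (enc b) = Data.cons (enc a') (enc b') := h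
  rw [hα (Data.cons.inj h').1, hβ (Data.cons.inj h').2]

theorem enc_list_injective {α : Type} [Enc α] (hα : Function.Injective (enc : α → Data)) :
    Function.Injective (enc : List α → Data) := by
  intro l
  induction l with
  | nil => intro l' h; cases l' <;> simp_all [enc, Data.ofList]
  | cons a l ih =>
    intro l' h
    cases l' with
    | nil => simp [enc, Data.ofList] at h
    | cons a' l' =>
      have h' : Data.cons (enc a) (enc l) = Data.cons (enc a') (enc l') := h
      rw [hα (Data.cons.inj h').1, ih (Data.cons.inj h').2]

theorem encode_injective : Function.Injective (enc : InputGraph → Data) := by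
  rintro ⟨n, m, g⟩ ⟨n', m', g'⟩ h
  rw [← enc_raw, ← enc_raw] at h
  have h1 := enc_prod_injective enc_nat_injective
    (enc_list_injective (enc_prod_injective enc_nat_injective enc_nat_injective)) h
  simp only [raw, Prod.mk.injEq] at h1
  obtain ⟨rfl, h2⟩ := h1
  have h3 := congrArg List.length h2
  simp only [List.length_ofFn] at h3
  subst h3
  have h4 := List.ofFn_injective h2
  have h5 : g.base = g'.base := funext fun d => Fin.ext (Prod.mk.inj (congrFun h4 d)).1
  have h6 : g.inv = g'.inv := funext fun d => Fin.ext (Prod.mk.inj (congrFun h4 d)).2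
  cases g; cases g'; simp_all

/-- The size bounds the number of vertices and, through the links, that of darts. As graphs are
numbered, no passage to isomorphism classes is needed. -/
theorem finite_size_le (k : ℕ) : {G : InputGraph | G.graph.size ≤ k}.Finite := by
  refine (Set.finite_range fun x : Σ n : Fin (k + 1), Σ m : Fin (2 * k + 1),
    DartGraph (Fin n) (Fin m) => InputGraph.mk x.1 x.2.1 x.2.2).subset fun G hG => ?_
  have h1 := G.graph.le_two_mul_links_ncard
  have h2 := G.graph_size
  have h3 : G.graph.size ≤ k := hG
  exact ⟨⟨⟨G.numVertices, by omega⟩, ⟨G.numDarts, by omega⟩, G.graph⟩, rfl⟩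

variable {V D : Type*} (G H : InputGraph)

theorem componentGraph_covers_iff {c : G.graph.Component} {K : DartGraph V D} :
    (G.componentGraph c).graph.Covers K ↔ (G.graph.component c).Covers K :=
  ⟨(G.covers_componentGraph c).trans, (G.componentGraph_covers c).trans⟩

theorem covers_componentGraph_iff {c : H.graph.Component} {K : DartGraph V D} :
    K.Covers (H.componentGraph c).graph ↔ K.Covers (H.graph.component c) :=
  ⟨fun h => h.trans (H.componentGraph_covers c), fun h => h.trans (H.covers_componentGraph c)⟩

theorem size_componentGraph (c : G.graph.Component) :
    (G.componentGraph c).graph.size = (G.graph.component c).size :=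
  DartGraph.size_eq_of_covers (G.componentGraph_covers c) (G.covers_componentGraph c)

theorem surjectivelyCovers_iff_components [Finite V] {H : DartGraph V D} :
    G.graph.SurjectivelyCovers H ↔
      (∀ C ∈ G.components, ∃ c' : H.Component, C.graph.Covers (H.component c')) ∧
      ∀ S : Finset H.Component, S.card ≤
        (G.components.filterP fun C => ∃ c' ∈ S, C.graph.Covers (H.component c')).length := by
  rw [DartGraph.surjectivelyCovers_iff_card, forall_mem_components]
  simp only [length_filterP_components, componentGraph_covers_iff]

/-- Whether a component of `G` covers a member of a set `S` of components of `H` depends only on the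
types in `S`. Adding all components of these types leaves the right side of Hall's inequality
unchanged and can only increase the left side, so it suffices to test sets of types. -/
theorem surjectivelyCovers_iff_types (𝒯 : Finset InputGraph) (h : ∀ C ∈ H.components, C ∈ 𝒯) :
    G.graph.SurjectivelyCovers H.graph ↔
      (∀ C ∈ G.components, ∃ T ∈ 𝒯, T ∈ H.components ∧ C.graph.Covers T.graph) ∧
      ∀ S ∈ 𝒯.powerset, (H.components.filterP fun C => C ∈ S).length ≤
        (G.components.filterP fun C => ∃ T ∈ S, C.graph.Covers T.graph).length := by
  classical
  have := Fintype.ofFinite H.graph.Component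
  have := Fintype.ofFinite G.graph.Component
  rw [forall_mem_components] at h
  rw [surjectivelyCovers_iff_components]
  refine and_congr (forall₂_congr fun C _ => ?_) ⟨fun h' S _ => ?_, fun h' S => ?_⟩
  · have e : (∃ T ∈ 𝒯, T ∈ H.components ∧ C.graph.Covers T.graph) ↔
        ∃ T ∈ H.components, T ∈ 𝒯 ∧ C.graph.Covers T.graph := by tauto
    rw [e, exists_mem_components]
    simp only [h, true_and, covers_componentGraph_iff]
  -- A set of types gives the set of all components with these types.
  · refine le_trans ?_ ((h' (Finset.univ.filter fun c => H.componentGraph c ∈ S)).trans ?_)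
    · rw [length_filterP_components, Nat.card_eq_fintype_card, Fintype.card_subtype]
    · rw [length_filterP_components, length_filterP_components]
      refine Nat.card_mono (Set.toFinite _) ?_
      rintro c ⟨c', hc', hc⟩
      exact ⟨_, (Finset.mem_filter.1 hc').2, H.covers_componentGraph_iff.2 hc⟩
  -- A set of components gives the set of its types.
  · refine le_trans ?_ ((h' (S.image H.componentGraph) ?_).trans ?_)
    · rw [length_filterP_components, Nat.card_eq_fintype_card, Fintype.card_subtype]
      refine Finset.card_le_card fun c hc => ?_
      simp only [Finset.mem_filter, Finset.mem_univ, true_and]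
      exact Finset.mem_image_of_mem _ hc
    · rw [Finset.mem_powerset]
      intro T hT
      obtain ⟨c, -, rfl⟩ := Finset.mem_image.1 hT
      exact h c
    · rw [length_filterP_components, length_filterP_components]
      refine Nat.card_mono (Set.toFinite _) ?_
      rintro c ⟨T, hT, hc⟩
      obtain ⟨c', hc', rfl⟩ := Finset.mem_image.1 hT
      exact ⟨c', hc', H.covers_componentGraph_iff.1 hc⟩

end InputGraph

/-! ### Polynomial-time decision of surjective covers -/

namespace PTP

variable {V D : Type*} {α γ : Type} [Enc α] [Enc γ]

theorem decidesWithin {P : α → Prop} (h : PTP P) : ∃ (p : Cmd) (T : α → ℕ), PolyLe T sz ∧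
    ∀ a, p.DecidesWithin (enc a) (P a) (T a) := by
  obtain ⟨p, T, hp, hT, -⟩ := h
  refine ⟨p, T, hT, fun a => ?_⟩
  obtain ⟨n, hn, h⟩ := hp a
  refine ⟨_, n, h, hn, ?_⟩
  by_cases hP : P a <;> simp [Store.init, enc, hP]

theorem covers {H : DartGraph V D} (h : H.coverProblem.PolyTime) :
    PTP fun G : InputGraph => G.graph.Covers H := by
  obtain ⟨p, k, hp⟩ := h
  have hs : PolyLe (fun G : InputGraph => G.graph.size) sz := .of_le InputGraph.size_le_sz
  refine ⟨p.normalize, fun G => k * G.graph.size ^ k + k + (2 * p.bnd + 10), fun G => ?_,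
    (hs.of_mul_pow_add k).add (.const _ _), (PolyLe.const 3 _).mono fun a => sz_bool_le _⟩
  refine Cmd.DecidesWithin.runs_normalize (P := G.graph.Covers H) (hp G trivial) _
    (fun hc => ?_) (fun hc => ?_) <;> simp [enc, hc]

theorem eq_inputGraph {G : γ → InputGraph} (hG : PT G) (T : InputGraph) : PTP fun x => G x = T :=
  (enc_eq_const hG (enc T)).congr fun _ => InputGraph.encode_injective.eq_iff.symm

theorem mem_finset {G : γ → InputGraph} (hG : PT G) (S : Finset InputGraph) :
    PTP fun x => G x ∈ S :=
  (exists_finset S fun T _ => eq_inputGraph hG T).congr fun x => by simp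

/-- `H` is fixed, so its components, their sets and the deciders are all built into the program;
only the counting depends on the input. -/
theorem surjectivelyCovers [Finite V] {H : DartGraph V D} (h : H.ComponentsPolyTime) :
    PTP fun G : InputGraph => G.graph.SurjectivelyCovers H := by
  classical
  have := Fintype.ofFinite H.Component
  have hc : ∀ S : Finset H.Component,
      PTP fun C : InputGraph => ∃ c' ∈ S, C.graph.Covers (H.component c') :=
    fun S => exists_finset S fun c' _ => covers (h c')
  refine ((forall_mem (P := fun _ C => ∃ c' ∈ Finset.univ, C.graph.Covers (H.component c'))
    PT.id.components ((hc Finset.univ).comp PT.id.snd)).and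
    (forall_finset (P := fun S (G : InputGraph) => S.card ≤ (G.components.filterP fun C =>
      ∃ c' ∈ S, C.graph.Covers (H.component c')).length) Finset.univ fun S _ =>
        nat_le (m := fun _ => S.card) (PT.const S.card) (PT.id.components.filterP
          (P := fun _ C => ∃ c' ∈ S, C.graph.Covers (H.component c'))
          ((hc S).comp PT.id.snd)).length)).congr fun G => ?_
  rw [InputGraph.surjectivelyCovers_iff_components]
  simp

/-- That the types lie in `𝒯` is part of what is decided, so the program is correct on all pairs,
without a promise. -/
theorem surjectivelyCovers_of_types (𝒯 : Finset InputGraph)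
    (h : ∀ T ∈ 𝒯, T.graph.coverProblem.PolyTime) :
    PTP fun x : InputGraph × InputGraph =>
      (∀ C ∈ x.2.components, C ∈ 𝒯) ∧ x.1.graph.SurjectivelyCovers x.2.graph := by
  have h1 : PT fun x : InputGraph × InputGraph => x.1.components := PT.id.fst.components
  have h2 : PT fun x : InputGraph × InputGraph => x.2.components := PT.id.snd.components
  refine ((forall_mem (P := fun _ C => C ∈ 𝒯) h2 (mem_finset PT.id.snd 𝒯)).and
    ((forall_mem (P := fun x C => ∃ T ∈ 𝒯, T ∈ x.2.components ∧ C.graph.Covers T.graph) h1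
      (exists_finset 𝒯 fun T hT => .and ?_ ((covers (h T hT)).comp PT.id.snd))).and
    (forall_finset (P := fun S (x : InputGraph × InputGraph) =>
      (x.2.components.filterP fun C => C ∈ S).length ≤
        (x.1.components.filterP fun C => ∃ T ∈ S, C.graph.Covers T.graph).length) 𝒯.powerset
      fun S hS => nat_le (h2.filterP (P := fun _ C => C ∈ S) (mem_finset PT.id.snd S)).length
        (h1.filterP (P := fun _ C => ∃ T ∈ S, C.graph.Covers T.graph)
          (exists_finset S fun T hT =>
            (covers (h T (Finset.mem_powerset.1 hS hT))).comp PT.id.snd)).length))).congr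
      fun x => ?_
  · exact (exists_mem (P := fun _ C => C = T) (h2.comp PT.id.fst)
      (eq_inputGraph PT.id.snd T)).congr fun x => by simp
  · exact and_congr_right fun h => InputGraph.surjectivelyCovers_iff_types _ _ 𝒯 h

end PTP

/-! ### Components of bounded size: the slices and the main theorem -/

/-- The graphs of size at most `k` for which covers can be recognized in polynomial time. -/
noncomputable def easyGraphs (k : ℕ) : Finset InputGraph :=
  ((InputGraph.finite_size_le k).inter_of_left
    {T : InputGraph | T.graph.coverProblem.PolyTime}).toFinset

theorem mem_easyGraphs {k : ℕ} {T : InputGraph} :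
    T ∈ easyGraphs k ↔ T.graph.size ≤ k ∧ T.graph.coverProblem.PolyTime := by
  simp [easyGraphs]

/-- The promise on `H` passes to the renumbered components because they cover, and are covered by,
the original ones. Membership thus becomes a mere bound on the size. -/
theorem componentGraph_mem_easyGraphs {H : InputGraph} (h : H.graph.ComponentsPolyTime)
    {k : ℕ} {c : H.graph.Component} :
    H.componentGraph c ∈ easyGraphs k ↔ (H.graph.component c).size ≤ k := by
  rw [mem_easyGraphs, H.size_componentGraph]
  exact and_iff_left (DartGraph.polyTime_coverProblem_congr (H.covers_componentGraph c)
    (H.componentGraph_covers c) (h c))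

theorem polyLe_sz_inputGraph : PolyLe (fun G : InputGraph => sz G) fun G => G.graph.size :=
  ((PolyLe.const 40 _).mul (((PolyLe.refl _)).pow 2)).mono fun G =>
    G.sz_le.trans (Nat.mul_le_mul_left _ (Nat.pow_le_pow_left (by omega) 2))

theorem polyLe_sz_pair : PolyLe (fun x : InputGraph × InputGraph => sz x)
    fun x => x.1.graph.size + x.2.graph.size :=
  ((((polyLe_sz_inputGraph.comp Prod.fst).trans (.of_le fun _ => Nat.le_add_right _ _)).add
    ((polyLe_sz_inputGraph.comp Prod.snd).trans (.of_le fun _ => Nat.le_add_left _ _))).add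
      (.const 1 _))

theorem PTP.exists_component_mem (S : Finset InputGraph) :
    PTP fun x : InputGraph × InputGraph => ∃ C ∈ x.2.components, C ∈ S :=
  PTP.exists_mem (P := fun _ C => C ∈ S) PT.id.snd.components (PTP.mem_finset PT.id.snd S)

/-- The program tests that all components of `H` lie in `easyGraphs k`, that some component has size
exactly `k` unless `k = 0`, and Hall's condition on types. The promise serves only to interpret the
answer. -/
theorem exists_decidesWithin_maxComponentSize_eq (k : ℕ) : ∃ a b : ℕ, ∃ p : Cmd,
    ∀ x : InputGraph × InputGraph, x.2.graph.ComponentsPolyTime → p.DecidesWithin (enc x)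
      (x.1.graph.SurjectivelyCovers x.2.graph ∧ x.2.graph.maxComponentSize = k)
      (a * (x.1.graph.size + x.2.graph.size + 1) ^ b) := by
  classical
  have h1 := PTP.surjectivelyCovers_of_types (easyGraphs k) fun T hT => (mem_easyGraphs.1 hT).2
  have h2 := PTP.exists_component_mem ((easyGraphs k).filter fun T => T.graph.size = k)
  obtain ⟨p, T, hT, hp⟩ := (h1.and ((PTP.const (k = 0)).or h2)).decidesWithin
  obtain ⟨a, b, hab⟩ := (hT.trans polyLe_sz_pair).exists_mul_succ_pow
  refine ⟨a, b, p, fun x hx => ?_⟩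
  obtain ⟨t, n, h3, h4, h5⟩ := hp x
  refine ⟨t, n, h3, h4.trans (hab x), h5.trans ?_⟩
  rw [DartGraph.maxComponentSize_eq_iff, InputGraph.forall_mem_components,
    InputGraph.exists_mem_components]
  have e : ∀ c, (x.2.componentGraph c ∈ (easyGraphs k).filter fun T => T.graph.size = k) ↔
      (x.2.graph.component c).size = k := fun c => by
    rw [Finset.mem_filter, componentGraph_mem_easyGraphs hx, x.2.size_componentGraph]
    exact and_iff_right_of_imp le_of_eq
  simp only [componentGraph_mem_easyGraphs hx, e]
  tauto

theorem surjectiveCover_inXP :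
    (surjectiveCover.restrict fun x : InputGraph × InputGraph =>
        x.2.graph.ComponentsPolyTime).InXP
      (fun x : InputGraph × InputGraph => x.2.graph.maxComponentSize) := by
  choose f g p h using exists_decidesWithin_maxComponentSize_eq
  exact ⟨f, g, fun k => ⟨p k, fun x hx => h k x hx.2⟩⟩

theorem surjectiveCover_polyTime_of_size_le (M : ℕ) :
    (surjectiveCover.restrict fun x : InputGraph × InputGraph =>
        x.2.graph.ComponentsPolyTime ∧ ∀ c, (x.2.graph.component c).size ≤ M).PolyTime := by
  obtain ⟨p, T, hT, hp⟩ := (PTP.surjectivelyCovers_of_types (easyGraphs M)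
    fun T hT => (mem_easyGraphs.1 hT).2).decidesWithin
  obtain ⟨k, hk⟩ := (hT.trans polyLe_sz_pair).exists_mul_pow_add
  refine ⟨p, k, fun (x : InputGraph × InputGraph) hx => ?_⟩
  obtain ⟨t, n, h3, h4, h5⟩ := hp x
  refine ⟨t, n, h3, h4.trans (hk x), h5.trans (and_iff_right ?_)⟩
  rw [InputGraph.forall_mem_components]
  exact fun c => (componentGraph_mem_easyGraphs hx.2.1).2 (hx.2.2 c)

theorem DartGraph.surjectiveCoverProblem_polyTime {V D : Type*} [Finite V] (H : DartGraph V D)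
    (h : H.ComponentsPolyTime) : H.surjectiveCoverProblem.PolyTime := by
  obtain ⟨p, T, hT, hp⟩ := (PTP.surjectivelyCovers h).decidesWithin
  obtain ⟨k, hk⟩ := (hT.trans polyLe_sz_inputGraph).exists_mul_pow_add
  refine ⟨p, k, fun (x : InputGraph) _ => ?_⟩
  obtain ⟨t, n, h3, h4, h5⟩ := hp x
  exact ⟨t, n, h3, h4.trans (hk x), h5⟩

theorem mainTheorem4 :
    (∀ (V D : Type*) [Finite V] [Finite D] (H : DartGraph V D),
      H.ComponentsPolyTime → H.surjectiveCoverProblem.PolyTime) ∧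
    (surjectiveCover.restrict fun x : InputGraph × InputGraph =>
        x.2.graph.ComponentsPolyTime).InXP
      (fun x : InputGraph × InputGraph => x.2.graph.maxComponentSize) ∧
    (∀ M : ℕ, (surjectiveCover.restrict fun x : InputGraph × InputGraph =>
        x.2.graph.ComponentsPolyTime ∧ ∀ c, (x.2.graph.component c).size ≤ M).PolyTime) :=
  ⟨fun _ _ _ _ H h => H.surjectiveCoverProblem_polyTime h, surjectiveCover_inXP,
    surjectiveCover_polyTime_of_size_le⟩
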